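/- Let $K$ be a field and let $A=K[a_1,\ldots,a_n]$ be a solvable polynomial algebra: an associative unital $K$-algebra such that the monomials $a^{\alpha}=a_1^{\alpha_1}\cdots a_n^{\alpha_n}$, $\alpha\in\mathbb N^n$, form a $K$-basis of $A$, with a total well-ordering $\prec$ of these monomials that satisfies, writing $\mathrm{LM}$ for the leading (largest) monomial: (i) if $a^\gamma\neq 1$, $a^\beta\ne a^\gamma$ and $a^{\gamma}=\mathrm{LM}(a^{\alpha}a^{\beta}a^{\eta})$, then $a^\beta\prec a^\gamma$; (ii) if $a^\alpha\prec a^\beta$, $a^\gamma a^\alpha a^\eta\neq0$, $a^\gamma a^\beta a^\eta\ne 0$ and $\mathrm{LM}(a^\gamma a^\beta a^\eta)\neq 1$, then $\mathrm{LM}(a^\gamma a^\alpha a^\eta)\prec \mathrm{LM}(a^\gamma a^\beta a^\eta)$; (iii) $a^\alpha a^\beta=\lambda_{\alpha,\beta}a^{\alpha+\beta}+f_{\alpha,\beta}$ with $\lambda_{\alpha,\beta}\in K^*$ and $f_{\alpha,\beta}=0$ or $\mathrm{LM}(f_{\alpha,\beta})\prec a^{\alpha+\beta}$. Let $P$ be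 a finitely generated projective left $A$-module. Then $P$ is stably free: there is a unique $t\in\mathbb N$, the rank of $P$, such that $P\oplus A^s\cong A^{s+t}$ for some $s\in\mathbb N$. For every finite free resolution $0\to L_q\to\cdots\to L_1\to L_0\to P\to 0$ by free modules $L_i$ with finite bases, $t=\sum_{i=0}^q(-1)^i\,\mathrm{rank}\,L_i$. Moreover, the rank is computed by the following algorithm (Algorithm-FRES). A left monomial ordering on $L=A^s=\bigoplus_{i=1}^sAe_i$ is a total ordering $\prec_e$ of the monomials $a^\alpha e_i$ such that $u\prec_e v$ implies $\mathrm{LM}(a^\gamma u)\prec_e\mathrm{LM}(a^\gamma v)$ for all monomials $u,v$ of $L$ and all $\gamma$, and $a^\alpha\prec a^\beta$ implies $a^\alpha e_i\prec_e a^\beta e_i$. A finite left Gröbner basis of a submodule $N\subseteq L$ is a finite family of nonzero elements of $N$ such that for every nonzero $\xi\in N$ some member $g$ and some $a^\gamma$ satisfy $\mathrm{LM}(\xi)=\mathrm{LM}(a^\gamma\,\mathrm{LM}(g))$. An input consists of a surjection $\varphi_0\colon L_0=A^s\to P$, a left monomial ordering on $L_0$, and a finite left Gröbner basis $\mathcal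 G_0$ of $\ker\varphi_0$; put $i=0$. (1) If some leading monomial of $\mathcal G_i\subset L_i$ is not of the form $e_k$: relabel $\mathcal G_i=(g_1,\ldots,g_m)$ so that, among members with leading monomials in the same component, the exponents of the leading monomials increase weakly in the lexicographic order. Put $L_{i+1}=\bigoplus_{j=1}^mA\varepsilon_j$, $\varphi_{i+1}(\varepsilon_j)=g_j$. Order the monomials of $L_{i+1}$ by the Schreyer ordering: $a^\alpha\varepsilon_j\prec a^\beta\varepsilon_l$ iff $\mathrm{LM}(a^\alpha g_j)\prec\mathrm{LM}(a^\beta g_l)$, or these are equal and $j<l$. For each pair $j<l$ with $\mathrm{LM}(g_j)=a^\alpha e_k$, $\mathrm{LM}(g_l)=a^\beta e_k$ in the same component, put $\gamma=\max(\alpha,\beta)$ componentwise, $u=\mathrm{LC}(a^{\gamma-\alpha}g_j)^{-1}a^{\gamma-\alpha}$, $v=\mathrm{LC}(a^{\gamma-\beta}g_l)^{-1}a^{\gamma-\beta}$ ($\mathrm{LC}$ denoting leading coefficients), divide $ug_j-vg_l$ by $(g_1,\ldots,g_m)$ with the left division algorithm, which returns quotients $f_1,\ldots,f_m\in A$, and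 form $s_{jl}=\sum_h f_h\varepsilon_h-u\varepsilon_j+v\varepsilon_l$. Let $\mathcal G_{i+1}$ be the family of all these $s_{jl}$, replace $i$ by $i+1$, and repeat. (The left division algorithm reduces the current element $\omega\ne0$ by subtracting $\mathrm{LC}(\omega)\,\mathrm{LC}(a^\delta g_h)^{-1}a^\delta g_h$, and adding the coefficient to $f_h$, for the least $h$ such that $\mathrm{LM}(\omega)=\mathrm{LM}(a^\delta\,\mathrm{LM}(g_h))$ for some $\delta$; if there is none, it moves the leading term of $\omega$ to the remainder; it stops when $\omega=0$.) (2) If all leading monomials of $\mathcal G_i$ are of the form $e_k$: return $0\to F\to L_{i-1}\to\cdots\to L_0\to P\to0$ (read $0\to F\to P\to 0$ if $i=0$), where $F\subseteq L_i$ is the free submodule on the $e_k$ that are not leading monomials of members of $\mathcal G_i$, mapped by the restriction of $\varphi_i$. For every surjection $\varphi_0\colon A^s\to P$ an input with this $\varphi_0$ exists. On every input, whatever relabelings and enumerations are chosen, the algorithm runs without getting stuck, stops after at most $n$ passes through step (1), and returns a finite free resolution of $P$ of length at most $n$; the alternating sum of the ranks of the modules in this resolution is the rank $t$ of $P$. 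-/

import Mathlib

noncomputable section

/-- The leading index of a family of coefficients `c`, with respect to the strict ordering `lt`
on the index set: the largest index at which `c` does not vanish. -/
def IsLeading {ι R : Type*} [Zero R] (lt : ι → ι → Prop) (c : ι → R) (m : ι) : Prop :=
  c m ≠ 0 ∧ ∀ j, c j ≠ 0 → j ≠ m → lt j m

/-- A solvable polynomial algebra `A = K[a₁, …, aₙ]` with its admissible system: the ordered
monomials `a^α = a₁^α₁ ⋯ aₙ^αₙ` form a `K`-basis of `A` (the PBW basis), `lt` is a monomial
ordering on them (written on exponents), and
`a^α a^β = c a^(α+β) + f` with `c ≠ 0` and `LM(f) ≺ a^(α+β)` if `f ≠ 0`. -/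
structure SolvablePolynomialAlgebra (K A : Type*) [Field K] [Ring A] [Algebra K A] (n : ℕ) where
  /-- the generators `a₁, …, aₙ` -/
  gen : Fin n → A
  /-- the PBW basis -/
  pbw : Module.Basis (Fin n → ℕ) K A
  pbw_eq : ∀ α : Fin n → ℕ, pbw α = (List.ofFn fun i => gen i ^ α i).prod
  /-- the monomial ordering -/
  lt : (Fin n → ℕ) → (Fin n → ℕ) → Prop
  isStrictTotalOrder : IsStrictTotalOrder (Fin n → ℕ) lt
  wellFounded : WellFounded lt
  lt_of_isLeading : ∀ α β η γ : Fin n → ℕ, γ ≠ 0 → β ≠ γ →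
    IsLeading lt (pbw.repr (pbw α * pbw β * pbw η)) γ → lt β γ
  lt_mul_of_lt : ∀ γ α β η μ ν : Fin n → ℕ, lt α β →
    IsLeading lt (pbw.repr (pbw γ * pbw α * pbw η)) μ →
    IsLeading lt (pbw.repr (pbw γ * pbw β * pbw η)) ν → ν ≠ 0 → lt μ ν
  mul_eq : ∀ α β : Fin n → ℕ, ∃ c : K, c ≠ 0 ∧ ∃ f : A,
    pbw α * pbw β = c • pbw (α + β) + f ∧ ∀ μ, IsLeading lt (pbw.repr f) μ → lt μ (α + β)

/-- `P` is stably free of rank `t`: `P ⊕ A^s ≅ A^(s+t)` for some `s`. -/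
def IsStablyFreeOfRank (A P : Type*) [Ring A] [AddCommGroup P] [Module A P] (t : ℕ) : Prop :=
  ∃ s : ℕ, Nonempty ((P × (Fin s → A)) ≃ₗ[A] (Fin (s + t) → A))

/-- Sequences `L_q → ⋯ → L₁ → L₀ → M` of `A`-linear maps, where each `L_i` is a finitely
generated free module with a chosen basis, `L_i = A^(r_i)`. The index is the rank of the last
module `L_q`. -/
inductive FreeSequence (A M : Type*) [Ring A] [AddCommGroup M] [Module A M] : ℕ → Type _
  | base {r : ℕ} (φ₀ : (Fin r → A) →ₗ[A] M) : FreeSequence A M r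
  | snoc {r r' : ℕ} (C : FreeSequence A M r) (φ : (Fin r' → A) →ₗ[A] (Fin r → A)) :
      FreeSequence A M r'

namespace FreeSequence

variable {A M : Type*} [Ring A] [AddCommGroup M] [Module A M]

/-- The length `q` of `L_q → ⋯ → L₀ → M`. -/
def length : {r : ℕ} → FreeSequence A M r → ℕ
  | _, base _ => 0
  | _, snoc C _ => C.length + 1

/-- The alternating sum `∑ i ≤ q, (-1)^i rank L_i`. -/
def altRank : {r : ℕ} → FreeSequence A M r → ℤ
  | r, base _ => (r : ℤ)
  | r, snoc C _ => C.altRank + (-1) ^ (C.length + 1) * (r : ℤ)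

/-- The kernel of the leftmost map, a submodule of `L_q`. -/
def kerLast : {r : ℕ} → FreeSequence A M r → Submodule A (Fin r → A)
  | _, base φ₀ => LinearMap.ker φ₀
  | _, snoc _ φ => LinearMap.ker φ

/-- Exactness of `L_q → ⋯ → L₀ → M → 0` at `M` and at `L_i`, `i < q`. -/
def IsExact : {r : ℕ} → FreeSequence A M r → Prop
  | _, base φ₀ => Function.Surjective φ₀
  | _, snoc C φ => C.IsExact ∧ LinearMap.range φ = C.kerLast

/-- `0 → L_q → ⋯ → L₀ → M → 0` is exact, i.e. a finite free resolution of `M`. -/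
def IsFiniteFreeResolution {r : ℕ} (C : FreeSequence A M r) : Prop :=
  C.IsExact ∧ C.kerLast = ⊥

/-- Replace the last module `L_q` by a free module `F` along a map `ι : F → L_q`. -/
def precomp {r r' : ℕ} (C : FreeSequence A M r) (ι : (Fin r' → A) →ₗ[A] (Fin r → A)) :
    FreeSequence A M r' :=
  match C with
  | base φ₀ => base (φ₀ ∘ₗ ι)
  | snoc C φ => snoc C (φ ∘ₗ ι)

end FreeSequence

/-- The state of the left division algorithm: quotients `q`, partial remainder `η`, and the
element `ω` that remains to be divided. -/
structure DivState (A : Type*) (s t : ℕ) where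
  q : Fin t → A
  η : Fin s → A
  ω : Fin s → A

/-- The state of the resolution algorithm: the sequence `L_i → ⋯ → L₀ → M` built so far, an
ordering of the monomials of `L_i = A^rank`, and a finite family `gb` of elements of `L_i`. -/
structure FRESState (n : ℕ) (A M : Type*) [Ring A] [AddCommGroup M] [Module A M] where
  rank : ℕ
  seq : FreeSequence A M rank
  lt : Fin rank × (Fin n → ℕ) → Fin rank × (Fin n → ℕ) → Prop
  card : ℕ
  gb : Fin card → Fin rank → A

namespace SolvablePolynomialAlgebra

variable {K A : Type*} [Field K] [Ring A] [Algebra K A] {n : ℕ}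
  (S : SolvablePolynomialAlgebra K A n)

/-- The monomial `a^α e_i` of the free module `A^s`, for `m = (i, α)`. -/
def mon {s : ℕ} (m : Fin s × (Fin n → ℕ)) : Fin s → A :=
  Pi.single m.1 (S.pbw m.2)

/-- The coefficient in `K` of the monomial `a^α e_i` in `ξ`, for `m = (i, α)`. -/
def coeff {s : ℕ} (ξ : Fin s → A) (m : Fin s × (Fin n → ℕ)) : K :=
  S.pbw.repr (ξ m.1) m.2

/-- `m` is the leading monomial of `ξ` with respect to `lt`. -/
def IsLM {s : ℕ} (lt : Fin s × (Fin n → ℕ) → Fin s × (Fin n → ℕ) → Prop)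
    (ξ : Fin s → A) (m : Fin s × (Fin n → ℕ)) : Prop :=
  IsLeading lt (S.coeff ξ) m

open Classical in
/-- The leading coefficient of `ξ` (zero if `ξ = 0`). -/
def lc {s : ℕ} (lt : Fin s × (Fin n → ℕ) → Fin s × (Fin n → ℕ) → Prop)
    (ξ : Fin s → A) : K :=
  if h : ∃ m, S.IsLM lt ξ m then S.coeff ξ h.choose else 0

/-- Left monomial orderings on the free module `A^s`. -/
structure IsLeftMonomialOrder {s : ℕ}
    (lt : Fin s × (Fin n → ℕ) → Fin s × (Fin n → ℕ) → Prop) : Prop where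
  isStrictTotalOrder : IsStrictTotalOrder (Fin s × (Fin n → ℕ)) lt
  lt_smul : ∀ (u v u' v' : Fin s × (Fin n → ℕ)) (γ : Fin n → ℕ), lt u v →
    S.IsLM lt (S.pbw γ • S.mon u) u' → S.IsLM lt (S.pbw γ • S.mon v) v' → lt u' v'
  lt_of_lt : ∀ (α β : Fin n → ℕ) (i : Fin s), S.lt α β → lt (i, α) (i, β)

/-- `G` is a (finite) left Gröbner basis of the submodule `N` of `A^s`: nonzero elements of `N`
such that the leading monomial of every nonzero `ξ ∈ N` is divisible from the left by the leading
monomial of a member of `G`. -/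
def IsLeftGroebnerBasis {s t : ℕ}
    (lt : Fin s × (Fin n → ℕ) → Fin s × (Fin n → ℕ) → Prop)
    (N : Submodule A (Fin s → A)) (G : Fin t → Fin s → A) : Prop :=
  (∀ j, G j ∈ N ∧ G j ≠ 0) ∧
    ∀ ξ ∈ N, ξ ≠ 0 → ∃ (j : Fin t) (u m : Fin s × (Fin n → ℕ)) (γ : Fin n → ℕ),
      S.IsLM lt (G j) u ∧ S.IsLM lt ξ m ∧ u.1 = m.1 ∧ S.IsLM lt (S.pbw γ • S.mon u) m

/-- One pass through the loop of the left division algorithm by `G = (g₁, …, g_t)`: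
if `LM(ω) = LM(a^γ LM(g_i))` for some `i` and `γ`, take the least such `i` and subtract the multiple
of `a^γ g_i` that cancels the leading term of `ω`; otherwise move the leading term of `ω` to the
remainder. -/
inductive DivStep {s t : ℕ}
    (lt : Fin s × (Fin n → ℕ) → Fin s × (Fin n → ℕ) → Prop) (G : Fin t → Fin s → A) :
    DivState A s t → DivState A s t → Prop
  | reduce (q : Fin t → A) (η ω : Fin s → A) (m u : Fin s × (Fin n → ℕ)) (i : Fin t)
      (γ : Fin n → ℕ) (c : K) (hω : S.IsLM lt ω m) (hu : S.IsLM lt (G i) u)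
      (hdvd : S.IsLM lt (S.pbw γ • S.mon u) m)
      (hleast : ∀ j < i, ¬ ∃ (v : Fin s × (Fin n → ℕ)) (δ : Fin n → ℕ),
        S.IsLM lt (G j) v ∧ S.IsLM lt (S.pbw δ • S.mon v) m)
      (hc : c = (S.lc lt (S.pbw γ • G i))⁻¹ * S.lc lt ω) :
      DivStep lt G ⟨q, η, ω⟩
        ⟨q + Pi.single i (c • S.pbw γ), η, ω - c • (S.pbw γ • G i)⟩
  | move (q : Fin t → A) (η ω : Fin s → A) (m : Fin s × (Fin n → ℕ)) (hω : S.IsLM lt ω m)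
      (hnone : ∀ j, ¬ ∃ (v : Fin s × (Fin n → ℕ)) (δ : Fin n → ℕ),
        S.IsLM lt (G j) v ∧ S.IsLM lt (S.pbw δ • S.mon v) m) :
      DivStep lt G ⟨q, η, ω⟩
        ⟨q, η + S.lc lt ω • S.mon m, ω - S.lc lt ω • S.mon m⟩

/-- The left division algorithm, run on `ξ` and `G`, stops and returns the quotients `q` and the
remainder `η`. -/
def DivReturns {s t : ℕ} (lt : Fin s × (Fin n → ℕ) → Fin s × (Fin n → ℕ) → Prop)
    (G : Fin t → Fin s → A) (ξ : Fin s → A) (q : Fin t → A) (η : Fin s → A) : Prop :=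
  Relation.ReflTransGen (S.DivStep lt G) ⟨0, 0, ξ⟩ ⟨q, η, 0⟩

/-- The Schreyer ordering on the monomials of `A^t` induced by `G = (g₁, …, g_t)`:
`a^α ε_i ≺ a^β ε_j` iff `LM(a^α g_i) ≺ LM(a^β g_j)`, or these are equal and `i < j`. -/
def schreyerLt {s t : ℕ} (lt : Fin s × (Fin n → ℕ) → Fin s × (Fin n → ℕ) → Prop)
    (G : Fin t → Fin s → A) (x y : Fin t × (Fin n → ℕ)) : Prop :=
  ∃ u v : Fin s × (Fin n → ℕ),
    S.IsLM lt (S.pbw x.2 • G x.1) u ∧ S.IsLM lt (S.pbw y.2 • G y.1) v ∧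
      (lt u v ∨ (u = v ∧ x.1 < y.1))

/-- The labelling of `G` is such that, for `i < j` with `LM(g_i) = a^α e_k` and
`LM(g_j) = a^β e_k` in the same component, `α ≤ β` lexicographically (with `a₁ ≻ ⋯ ≻ aₙ`). -/
def IsLexSorted {s t : ℕ} (lt : Fin s × (Fin n → ℕ) → Fin s × (Fin n → ℕ) → Prop)
    (G : Fin t → Fin s → A) : Prop :=
  ∀ (i j : Fin t) (k : Fin s) (α β : Fin n → ℕ), i < j →
    S.IsLM lt (G i) (k, α) → S.IsLM lt (G j) (k, β) → toLex α ≤ toLex β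

/-- The pairs `i < j` for which `LM(g_i)` and `LM(g_j)` lie in the same component of `A^s`. -/
def CriticalPair {s t : ℕ} (lt : Fin s × (Fin n → ℕ) → Fin s × (Fin n → ℕ) → Prop)
    (G : Fin t → Fin s → A) : Type :=
  {p : Fin t × Fin t // p.1 < p.2 ∧ ∃ (k : Fin s) (α β : Fin n → ℕ),
    S.IsLM lt (G p.1) (k, α) ∧ S.IsLM lt (G p.2) (k, β)}

/-- The coefficient `(1 / LC(a^δ g)) a^δ`, an element of `A`, for which
`(1 / LC(a^δ g)) a^δ g` has leading coefficient `1`. -/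
def normalizer {s : ℕ} (lt : Fin s × (Fin n → ℕ) → Fin s × (Fin n → ℕ) → Prop)
    (δ : Fin n → ℕ) (g : Fin s → A) : A :=
  (S.lc lt (S.pbw δ • g))⁻¹ • S.pbw δ

/-- `h` is the syzygy `s_ij ∈ A^t` of `G = (g₁, …, g_t)`: with `LM(g_i) = a^α e_k`,
`LM(g_j) = a^β e_k`, `γ = max(α, β)` and the left S-polynomial
`(1 / LC(a^(γ-α) g_i)) a^(γ-α) g_i - (1 / LC(a^(γ-β) g_j)) a^(γ-β) g_j`,
whose division by `G` returns the quotients `f₁, …, f_t`,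
`s_ij = ∑ f_l ε_l - (1 / LC(a^(γ-α) g_i)) a^(γ-α) ε_i + (1 / LC(a^(γ-β) g_j)) a^(γ-β) ε_j`. -/
def IsSyzygy {s t : ℕ} (lt : Fin s × (Fin n → ℕ) → Fin s × (Fin n → ℕ) → Prop)
    (G : Fin t → Fin s → A) (i j : Fin t) (h : Fin t → A) : Prop :=
  ∃ (k : Fin s) (α β : Fin n → ℕ) (f : Fin t → A) (η : Fin s → A),
    S.IsLM lt (G i) (k, α) ∧ S.IsLM lt (G j) (k, β) ∧
    S.DivReturns lt G
      (S.normalizer lt (α ⊔ β - α) (G i) • G i - S.normalizer lt (α ⊔ β - β) (G j) • G j) f η ∧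
    h = f - Pi.single i (S.normalizer lt (α ⊔ β - α) (G i))
      + Pi.single j (S.normalizer lt (α ⊔ β - β) (G j))

variable {M : Type*} [AddCommGroup M] [Module A M]

/-- The stopping condition: no generator `a₁, …, aₙ` appears in a leading monomial of the current
family, i.e. all these leading monomials are of the form `e_k`. -/
def FRESStops (x : FRESState n A M) : Prop :=
  ∀ (j : Fin x.card) (m : Fin x.rank × (Fin n → ℕ)), S.IsLM x.lt (x.gb j) m → m.2 = 0

/-- One pass through the loop of Algorithm-FRES, when the stopping condition fails: relabel the
current family `G = (g₁, …, g_t)` in `L_i` so that it is lexicographically sorted, put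
`L_{i+1} = A^t` and `φ_{i+1}(ε_j) = g_j`, and continue with the syzygies `s_ij` (over all critical
pairs, in any enumeration) and the Schreyer ordering on `L_{i+1}`. -/
inductive FRESStep : FRESState n A M → FRESState n A M → Prop
  | mk {s t r : ℕ} (C : FreeSequence A M s)
      (lt : Fin s × (Fin n → ℕ) → Fin s × (Fin n → ℕ) → Prop)
      (G G' : Fin t → Fin s → A) (H : Fin r → Fin t → A)
      (hgo : ¬ S.FRESStops ⟨s, C, lt, t, G⟩)
      (σ : Equiv.Perm (Fin t)) (hG' : G' = G ∘ σ) (hsort : S.IsLexSorted lt G')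
      (e : Fin r ≃ S.CriticalPair lt G')
      (hH : ∀ l, S.IsSyzygy lt G' (e l).1.1 (e l).1.2 (H l)) :
      FRESStep ⟨s, C, lt, t, G⟩
        ⟨t, C.snoc (Fintype.linearCombination A G'), S.schreyerLt lt G', r, H⟩

/-- The return statement of Algorithm-FRES, when the stopping condition holds: the last module
`L_i` of the sequence is replaced by the free submodule on those basis vectors `e_k` that are not
leading monomials of the current family (this submodule maps isomorphically onto the quotient of
`L_i` by the submodule generated by the family). -/
def FRESReturns (x : FRESState n A M) {d : ℕ} (R : FreeSequence A M d) : Prop :=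
  S.FRESStops x ∧
    ∃ e : Fin d ≃ {k : Fin x.rank // ∀ j, ¬ S.IsLM x.lt (x.gb j) (k, 0)},
      R = x.seq.precomp (Fintype.linearCombination A
        fun l : Fin d => (Pi.single (e l).1 1 : Fin x.rank → A))

/-- Valid inputs of Algorithm-FRES for the module `M`: a surjection `φ₀ : L₀ = A^s → M`, a left
monomial ordering on `L₀`, and a finite left Gröbner basis of `N₀ = ker φ₀`. -/
structure IsFRESInput {s t : ℕ} (φ₀ : (Fin s → A) →ₗ[A] M)
    (lt : Fin s × (Fin n → ℕ) → Fin s × (Fin n → ℕ) → Prop) (G : Fin t → Fin s → A) : Prop where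
  surjective : Function.Surjective φ₀
  isLeftMonomialOrder : S.IsLeftMonomialOrder lt
  isLeftGroebnerBasis : S.IsLeftGroebnerBasis lt (LinearMap.ker φ₀) G

/-- The state `x` is reached by Algorithm-FRES after `k` passes through the loop, when started on
the input `φ₀, lt, G`. -/
inductive FRESReaches {s t : ℕ} (φ₀ : (Fin s → A) →ₗ[A] M)
    (lt : Fin s × (Fin n → ℕ) → Fin s × (Fin n → ℕ) → Prop) (G : Fin t → Fin s → A) :
    ℕ → FRESState n A M → Prop
  | init : FRESReaches φ₀ lt G 0 ⟨s, .base φ₀, lt, t, G⟩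
  | step {k : ℕ} {x y : FRESState n A M} (hx : FRESReaches φ₀ lt G k x) (hxy : S.FRESStep x y) :
      FRESReaches φ₀ lt G (k + 1) y

end SolvablePolynomialAlgebra

end

/-! The exponents of leading monomials behave as in a commutative polynomial ring: LM(a^γ ξ) is
obtained by adding γ to the exponent of LM(ξ) (`IsLeftMonomialOrder.isLM_pbw_smul`). So division,
Dickson's lemma and Gröbner bases carry over to left submodules of A^s; in particular A is left
Noetherian, so ranks of free modules are well behaved.

The algorithm is correct and short for two reasons. By Schreyer's argument
(`isLeftGroebnerBasis_syzygies`) the s_ij form a Gröbner basis of the kernel of ε_j ↦ g_j, with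
LM(s_ij) = a^(max(α,β)-β) ε_j. If a_1, …, a_k are absent from the leading monomials of a
lexicographically sorted family, then α ≤ β in the next coordinate, so a_(k+1) is absent from the
new leading monomials as well (`IsSyzygy.leading_exponent_eq_zero`). After at most n passes only
monomials e_k lead. The last kernel is then complemented by the free module on the remaining basis
vectors, and restricting the last map to that complement ends the resolution
(`FRESInvariant.isFiniteFreeResolution`).

For projective P every kernel in an exact sequence of free modules splits off. Collecting the even
and odd terms of a finite resolution gives P ⊕ A^a ≅ A^b with b - a the alternating sum of ranks
(`FreeSequence.IsExact.exists_equiv`). The strong rank condition gives a ≤ b, and invariance of rank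
shows that b - a depends only on P. -/

section Leading

/-! ### Existence and uniqueness of leading indices -/

variable {ι R : Type*} [Zero R] {lt : ι → ι → Prop}

theorem IsLeading.unique [IsStrictTotalOrder ι lt] {c : ι → R} {m m' : ι}
    (h : IsLeading lt c m) (h' : IsLeading lt c m') : m = m' := by
  by_contra hne
  exact irrefl_of lt m (trans_of lt (h'.2 m h.1 hne) (h.2 m' h'.1 (Ne.symm hne)))

theorem Finset.exists_forall_lt_of_isStrictTotalOrder [IsStrictTotalOrder ι lt] (F : Finset ι)
    (hF : F.Nonempty) : ∃ m ∈ F, ∀ j ∈ F, j ≠ m → lt j m := by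
  classical
  induction hF using Finset.Nonempty.cons_induction with
  | singleton a => exact ⟨a, by simp, by simp⟩
  | cons a s ha hs ih =>
    obtain ⟨m, hm, hlt⟩ := ih
    rcases trichotomous_of lt a m with h | h | h
    · refine ⟨m, by simp [hm], fun j hj hne => ?_⟩
      rcases Finset.mem_cons.1 hj with rfl | hj
      · exact h
      · exact hlt j hj hne
    · exact absurd (h ▸ hm) ha
    · refine ⟨a, by simp, fun j hj hne => ?_⟩
      rcases Finset.mem_cons.1 hj with rfl | hj
      · exact absurd rfl hne
      · by_cases hjm : j = m
        · exact hjm ▸ h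
        · exact trans_of lt (hlt j hj hjm) h

theorem exists_isLeading [IsStrictTotalOrder ι lt] {c : ι → R} (hfin : (Function.support c).Finite)
    (hc : c ≠ 0) : ∃ m, IsLeading lt c m := by
  obtain ⟨m, hm, hlt⟩ := hfin.toFinset.exists_forall_lt_of_isStrictTotalOrder (lt := lt) (by
    obtain ⟨i, hi⟩ := Function.ne_iff.1 hc
    exact ⟨i, by simpa using hi⟩)
  exact ⟨m, by simpa using hm, fun j hj hne => hlt j (by simpa using hj) hne⟩

end Leading

/-! ### The monomial ordering of A, written on exponents -/

namespace SolvablePolynomialAlgebra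

variable {K A : Type*} [Field K] [Ring A] [Algebra K A] {n : ℕ}
  (S : SolvablePolynomialAlgebra K A n)

instance : IsStrictTotalOrder (Fin n → ℕ) S.lt := S.isStrictTotalOrder

theorem pbw_zero : S.pbw 0 = 1 := by
  rw [S.pbw_eq]
  exact List.prod_eq_one fun x hx => by
    obtain ⟨i, rfl⟩ := (List.mem_ofFn' _ _).1 hx
    simp

include S in
theorem nontrivial : Nontrivial A :=
  ⟨⟨S.pbw 0, 0, S.pbw.ne_zero 0⟩⟩

theorem exists_pbw_mul (α β : Fin n → ℕ) : ∃ c : K, c ≠ 0 ∧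
    ∀ μ, S.pbw.repr (S.pbw α * S.pbw β - c • S.pbw (α + β)) μ ≠ 0 → S.lt μ (α + β) := by
  obtain ⟨c, hc, f, hf, hlt⟩ := S.mul_eq α β
  refine ⟨c, hc, fun μ hμ => ?_⟩
  rw [hf, add_sub_cancel_left] at hμ
  obtain ⟨m, hm⟩ := exists_isLeading (lt := S.lt) (c := S.pbw.repr f) (Finsupp.hasFiniteSupport _)
    (fun h => hμ (congrFun h μ))
  by_cases h : μ = m
  · exact h ▸ hlt m hm
  · exact trans_of S.lt (hm.2 μ hμ h) (hlt m hm)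

theorem isLeading_pbw_mul (α β : Fin n → ℕ) :
    IsLeading S.lt (S.pbw.repr (S.pbw α * S.pbw β)) (α + β) := by
  obtain ⟨c, hc, h⟩ := S.exists_pbw_mul α β
  have key : ∀ μ, S.pbw.repr (S.pbw α * S.pbw β - c • S.pbw (α + β)) μ =
      S.pbw.repr (S.pbw α * S.pbw β) μ - c * Finsupp.single (α + β) (1 : K) μ := by
    intro μ
    rw [map_sub, map_smul, S.pbw.repr_self]
    rfl
  constructor
  · intro h0
    refine irrefl_of S.lt (α + β) (h _ ?_)
    rw [key, h0]
    simpa using hc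
  · intro j hj hne
    refine h _ ?_
    rw [key, Finsupp.single_eq_of_ne hne]
    simpa using hj

/-- Axiom (i) applied to the product 1 · 1 · a^α. -/
theorem zero_lt {α : Fin n → ℕ} (h : α ≠ 0) : S.lt 0 α := by
  refine S.lt_of_isLeading 0 0 α α h h.symm ?_
  simpa [S.pbw_zero] using S.isLeading_pbw_mul 0 α

theorem add_lt_add_left {α β : Fin n → ℕ} (γ : Fin n → ℕ) (h : S.lt α β) :
    S.lt (γ + α) (γ + β) := by
  refine S.lt_mul_of_lt γ α β 0 _ _ h ?_ ?_ ?_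
  · simpa [S.pbw_zero] using S.isLeading_pbw_mul γ α
  · simpa [S.pbw_zero] using S.isLeading_pbw_mul γ β
  -- Axiom (ii) excludes leading monomial 1; here that would force β = 0, but nothing lies below the
  -- exponent 0.
  · intro h0
    have hβ : β = 0 := by
      funext i
      have := congrFun h0 i
      simp at this
      exact this.2
    subst hβ
    by_cases hα : α = 0
    · exact irrefl_of S.lt 0 (hα ▸ h)
    · exact irrefl_of S.lt 0 (trans_of S.lt (S.zero_lt hα) h)

theorem le_of_pointwise_le {α β : Fin n → ℕ} (h : α ≤ β) : α = β ∨ S.lt α β := by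
  by_cases h0 : β - α = 0
  · left
    exact le_antisymm h (tsub_eq_zero_iff_le.1 h0)
  · right
    have := S.add_lt_add_left α (S.zero_lt h0)
    rwa [add_zero, add_tsub_cancel_of_le h] at this

/-! ### Leading monomials in the free modules A^s -/

section FreeModule

variable {s : ℕ}

theorem coeff_add (ξ η : Fin s → A) (m) : S.coeff (ξ + η) m = S.coeff ξ m + S.coeff η m := by
  simp [coeff]

theorem coeff_sub (ξ η : Fin s → A) (m) : S.coeff (ξ - η) m = S.coeff ξ m - S.coeff η m := by
  simp [coeff]

theorem coeff_smul (c : K) (ξ : Fin s → A) (m) : S.coeff (c • ξ) m = c * S.coeff ξ m := by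
  simp [coeff]

@[simp] theorem coeff_zero (m : Fin s × (Fin n → ℕ)) : S.coeff (0 : Fin s → A) m = 0 := by
  simp [coeff]

open Classical in
theorem coeff_mon (u v : Fin s × (Fin n → ℕ)) :
    S.coeff (S.mon u) v = if u = v then 1 else 0 := by
  obtain ⟨i, α⟩ := u
  obtain ⟨j, β⟩ := v
  by_cases h : j = i
  · subst h
    simp [coeff, mon, Finsupp.single_apply]
  · simp [coeff, mon, h, Ne.symm h]

theorem coeff_single (j : Fin s) (a : A) (m : Fin s × (Fin n → ℕ)) :
    S.coeff (Pi.single j a) m = if m.1 = j then S.pbw.repr a m.2 else 0 := by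
  by_cases h : m.1 = j
  · subst h
    simp [coeff]
  · simp [coeff, h]

theorem single_smul_pbw (j : Fin s) (c : K) (δ : Fin n → ℕ) :
    (Pi.single j (c • S.pbw δ) : Fin s → A) = c • S.mon (j, δ) := by
  ext i
  by_cases h : i = j
  · subst h; simp [mon]
  · simp [mon, Pi.single_eq_of_ne h]

theorem coeff_eq_zero_iff (ξ : Fin s → A) : S.coeff ξ = 0 ↔ ξ = 0 := by
  constructor
  · intro h
    funext i
    apply S.pbw.repr.injective
    ext α
    simpa [coeff] using congrFun h (i, α)
  · rintro rfl
    funext m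
    simp

theorem finite_support_coeff (ξ : Fin s → A) : (Function.support (S.coeff ξ)).Finite := by
  classical
  refine Set.Finite.subset (Finset.finite_toSet
    (Finset.univ ×ˢ Finset.univ.biUnion fun i => (S.pbw.repr (ξ i)).support)) ?_
  rintro ⟨i, α⟩ h
  simp only [Finset.coe_product, Set.mem_prod, Finset.coe_univ, Set.mem_univ, true_and,
    Finset.mem_coe, Finset.mem_biUnion, Finset.mem_univ]
  exact ⟨i, by simpa [coeff] using h⟩

theorem sum_coeff_smul_mon (ξ : Fin s → A) :
    ∑ m ∈ (S.finite_support_coeff ξ).toFinset, S.coeff ξ m • S.mon m = ξ := by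
  classical
  rw [← sub_eq_zero, ← S.coeff_eq_zero_iff]
  funext m
  have hsum : ∀ F : Finset (Fin s × (Fin n → ℕ)), S.coeff (∑ u ∈ F, S.coeff ξ u • S.mon u) m =
      ∑ u ∈ F, S.coeff ξ u * S.coeff (S.mon u) m := by
    intro F
    induction F using Finset.induction_on with
    | empty => simp
    | insert a F ha ih => rw [Finset.sum_insert ha, Finset.sum_insert ha, coeff_add, coeff_smul, ih]
  rw [coeff_sub, hsum]
  simp only [coeff_mon, mul_ite, mul_one, mul_zero, Finset.sum_ite_eq', Pi.zero_apply]
  by_cases h : S.coeff ξ m = 0 <;> simp [h]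

/-- The elements of `A^s` all of whose monomials are smaller than `m`. -/
def below (lt : Fin s × (Fin n → ℕ) → Fin s × (Fin n → ℕ) → Prop) (m : Fin s × (Fin n → ℕ)) :
    Submodule K (Fin s → A) where
  carrier := {ξ | ∀ u, S.coeff ξ u ≠ 0 → lt u m}
  add_mem' := by
    intro ξ η hξ hη u hu
    by_cases h : S.coeff ξ u = 0
    · refine hη u fun h' => hu ?_
      rw [coeff_add, h, h', add_zero]
    · exact hξ u h
  zero_mem' := by
    intro u hu
    simp at hu
  smul_mem' := by
    intro c ξ hξ u hu
    refine hξ u fun h => hu ?_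
    rw [coeff_smul, h, mul_zero]

variable {lt : Fin s × (Fin n → ℕ) → Fin s × (Fin n → ℕ) → Prop}

theorem below_mono [IsTrans _ lt] {m m' : Fin s × (Fin n → ℕ)} (h : lt m m') :
    S.below lt m ≤ S.below lt m' :=
  fun _ hξ u hu => trans_of lt (hξ u hu) h

theorem mon_mem_below {u m : Fin s × (Fin n → ℕ)} (h : lt u m) : S.mon u ∈ S.below lt m := by
  intro v hv
  rw [coeff_mon] at hv
  have : u = v := by by_contra hne; simp [hne] at hv
  exact this ▸ h

theorem IsLM.sub_mem_below {ξ : Fin s → A} {m : Fin s × (Fin n → ℕ)} (h : S.IsLM lt ξ m) :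
    ξ - S.coeff ξ m • S.mon m ∈ S.below lt m := by
  intro u hu
  rw [coeff_sub, coeff_smul, coeff_mon] at hu
  by_cases hum : m = u
  · subst hum; simp at hu
  · exact h.2 u (by simpa [hum] using hu) (Ne.symm hum)

theorem IsLM.ne_zero {ξ : Fin s → A} {m : Fin s × (Fin n → ℕ)} (h : S.IsLM lt ξ m) : ξ ≠ 0 := by
  rintro rfl
  exact h.1 (by simp)

theorem coeff_eq_of_sub_mem_below [Std.Irrefl lt] {ξ : Fin s → A} {m : Fin s × (Fin n → ℕ)} {c : K}
    (h : ξ - c • S.mon m ∈ S.below lt m) : S.coeff ξ m = c := by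
  by_contra hne
  refine irrefl_of lt m (h m ?_)
  rw [coeff_sub, coeff_smul, coeff_mon]
  simpa [sub_eq_zero] using hne

theorem isLM_of_sub_mem_below [Std.Irrefl lt] {ξ : Fin s → A} {m : Fin s × (Fin n → ℕ)} {c : K}
    (hc : c ≠ 0) (h : ξ - c • S.mon m ∈ S.below lt m) : S.IsLM lt ξ m := by
  refine ⟨by rwa [S.coeff_eq_of_sub_mem_below h], fun u hu hne => h u ?_⟩
  rw [coeff_sub, coeff_smul, coeff_mon]
  simpa [Ne.symm hne] using hu

theorem exists_isLM [IsStrictTotalOrder _ lt] {ξ : Fin s → A} (h : ξ ≠ 0) :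
    ∃ m, S.IsLM lt ξ m :=
  exists_isLeading (S.finite_support_coeff ξ) fun h0 => h ((S.coeff_eq_zero_iff ξ).1 h0)

theorem IsLM.unique [IsStrictTotalOrder _ lt] {ξ : Fin s → A} {m m' : Fin s × (Fin n → ℕ)}
    (h : S.IsLM lt ξ m) (h' : S.IsLM lt ξ m') : m = m' :=
  IsLeading.unique h h'

theorem IsLM.lc_eq [IsStrictTotalOrder _ lt] {ξ : Fin s → A} {m : Fin s × (Fin n → ℕ)}
    (h : S.IsLM lt ξ m) : S.lc lt ξ = S.coeff ξ m := by
  have hex : ∃ m, S.IsLM lt ξ m := ⟨m, h⟩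
  rw [lc, dif_pos hex, IsLM.unique S hex.choose_spec h]

/-- The leading exponent of `a^γ ξ` in terms of that of `ξ`. -/
def shift (γ : Fin n → ℕ) (m : Fin s × (Fin n → ℕ)) : Fin s × (Fin n → ℕ) := (m.1, γ + m.2)

@[simp] theorem shift_fst (γ : Fin n → ℕ) (m : Fin s × (Fin n → ℕ)) : (shift γ m).1 = m.1 := rfl

@[simp] theorem shift_snd (γ : Fin n → ℕ) (m : Fin s × (Fin n → ℕ)) :
    (shift γ m).2 = γ + m.2 := rfl

theorem shift_shift (γ δ : Fin n → ℕ) (m : Fin s × (Fin n → ℕ)) :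
    shift γ (shift δ m) = shift (γ + δ) m := by
  simp [shift, add_assoc]

theorem shift_injective_left {γ δ : Fin n → ℕ} {m : Fin s × (Fin n → ℕ)}
    (h : shift γ m = shift δ m) : γ = δ := by
  simpa [shift] using h

theorem exists_eq_shift_iff {u m : Fin s × (Fin n → ℕ)} :
    (∃ γ, m = shift γ u) ↔ u.1 = m.1 ∧ u.2 ≤ m.2 := by
  obtain ⟨i, α⟩ := u
  obtain ⟨j, β⟩ := m
  constructor
  · rintro ⟨γ, h⟩
    simp only [shift, Prod.mk.injEq] at h
    exact ⟨h.1.symm, by simp [h.2]⟩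
  · rintro ⟨h, h'⟩
    simp only at h h'
    exact ⟨β - α, by simp [shift, h, tsub_add_cancel_of_le h']⟩

/-- Only compatibility with the ordering of A inside each component is assumed, so that this can be
used to construct left monomial orderings, before the full axioms are known. -/
theorem exists_pbw_smul_mon_of_lt (hmono : ∀ (α β : Fin n → ℕ) (i : Fin s), S.lt α β →
    lt (i, α) (i, β)) (γ : Fin n → ℕ) (u : Fin s × (Fin n → ℕ)) :
    ∃ c : K, c ≠ 0 ∧ S.pbw γ • S.mon u - c • S.mon (shift γ u) ∈ S.below lt (shift γ u) := by
  obtain ⟨c, hc, h⟩ := S.exists_pbw_mul γ u.2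
  refine ⟨c, hc, fun v hv => ?_⟩
  have heq : S.pbw γ • S.mon u - c • S.mon (shift γ u) =
      Pi.single u.1 (S.pbw γ * S.pbw u.2 - c • S.pbw (γ + u.2)) := by
    ext i
    by_cases hi : i = u.1
    · subst hi; simp [mon]
    · simp [mon, Pi.single_eq_of_ne hi]
  rw [heq, coeff_single] at hv
  obtain ⟨i, α⟩ := v
  by_cases hi : i = u.1
  · subst hi
    exact hmono _ _ _ (h α (by simpa using hv))
  · simp [hi] at hv

theorem isLM_pbw_smul_mon_of_lt [Std.Irrefl lt] (hmono : ∀ (α β : Fin n → ℕ) (i : Fin s),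
    S.lt α β → lt (i, α) (i, β)) (γ : Fin n → ℕ) (u : Fin s × (Fin n → ℕ)) :
    S.IsLM lt (S.pbw γ • S.mon u) (shift γ u) := by
  obtain ⟨c, hc, h⟩ := S.exists_pbw_smul_mon_of_lt hmono γ u
  exact S.isLM_of_sub_mem_below hc h

/-- Products of monomials lead at the sum of exponents, so the axiom about leading monomials of
products becomes translation invariance. -/
theorem isLeftMonomialOrder_of_shift_lt [hlt : IsStrictTotalOrder _ lt]
    (hmono : ∀ (α β : Fin n → ℕ) (i : Fin s), S.lt α β → lt (i, α) (i, β))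
    (hshift : ∀ (γ : Fin n → ℕ) (u v : Fin s × (Fin n → ℕ)), lt u v →
      lt (shift γ u) (shift γ v)) : S.IsLeftMonomialOrder lt where
  isStrictTotalOrder := hlt
  lt_smul u v u' v' γ h hu hv := by
    rw [hu.unique S (S.isLM_pbw_smul_mon_of_lt hmono γ u),
      hv.unique S (S.isLM_pbw_smul_mon_of_lt hmono γ v)]
    exact hshift γ u v h
  lt_of_lt := hmono

variable (hlt : S.IsLeftMonomialOrder lt)

include hlt

theorem IsLeftMonomialOrder.isLM_pbw_smul_mon (γ : Fin n → ℕ) (u : Fin s × (Fin n → ℕ)) :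
    S.IsLM lt (S.pbw γ • S.mon u) (shift γ u) :=
  have := hlt.isStrictTotalOrder
  S.isLM_pbw_smul_mon_of_lt hlt.lt_of_lt γ u

theorem IsLeftMonomialOrder.isLM_pbw_smul_mon_iff {γ : Fin n → ℕ} {u m : Fin s × (Fin n → ℕ)} :
    S.IsLM lt (S.pbw γ • S.mon u) m ↔ m = shift γ u := by
  have := hlt.isStrictTotalOrder
  exact ⟨fun h => h.unique S (hlt.isLM_pbw_smul_mon S γ u),
    fun h => h ▸ hlt.isLM_pbw_smul_mon S γ u⟩

theorem IsLeftMonomialOrder.shift_lt {u v : Fin s × (Fin n → ℕ)} (γ : Fin n → ℕ) (h : lt u v) :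
    lt (shift γ u) (shift γ v) :=
  hlt.lt_smul u v _ _ γ h (hlt.isLM_pbw_smul_mon S γ u) (hlt.isLM_pbw_smul_mon S γ v)

theorem IsLeftMonomialOrder.pbw_smul_mem_below (γ : Fin n → ℕ) {m : Fin s × (Fin n → ℕ)}
    {ξ : Fin s → A} (hξ : ξ ∈ S.below lt m) : S.pbw γ • ξ ∈ S.below lt (shift γ m) := by
  have := hlt.isStrictTotalOrder
  rw [← S.sum_coeff_smul_mon ξ, Finset.smul_sum]
  refine Submodule.sum_mem _ fun u hu => ?_
  rw [smul_comm]
  refine Submodule.smul_mem _ _ ?_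
  have hum : lt (shift γ u) (shift γ m) := hlt.shift_lt S γ (hξ u (by simpa using hu))
  obtain ⟨c, -, h⟩ := S.exists_pbw_smul_mon_of_lt hlt.lt_of_lt γ u
  have := Submodule.add_mem _ (S.below_mono hum h)
    (Submodule.smul_mem _ c (S.mon_mem_below hum))
  rwa [sub_add_cancel] at this

/-- The leading term contributes a product of two nonzero scalars, and multiplication by a^γ keeps
the lower terms below. -/
theorem IsLeftMonomialOrder.isLM_pbw_smul (γ : Fin n → ℕ) {m : Fin s × (Fin n → ℕ)}
    {ξ : Fin s → A} (hξ : S.IsLM lt ξ m) : S.IsLM lt (S.pbw γ • ξ) (shift γ m) := by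
  have := hlt.isStrictTotalOrder
  obtain ⟨c, hc, h⟩ := S.exists_pbw_smul_mon_of_lt hlt.lt_of_lt γ m
  refine S.isLM_of_sub_mem_below (mul_ne_zero hξ.1 hc) ?_
  have h1 := hlt.pbw_smul_mem_below S γ (hξ.sub_mem_below S)
  have h2 := Submodule.smul_mem _ (S.coeff ξ m) h
  have := Submodule.add_mem _ h1 h2
  rw [smul_sub, smul_sub, smul_comm (S.pbw γ), smul_smul] at this
  simpa using this

/-- On each component the ordering agrees with the well-ordering of A, and a finite union of
well-founded pieces of a strict order is well-founded, however the components interleave. -/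
theorem IsLeftMonomialOrder.wellFounded : WellFounded lt := by
  have := hlt.isStrictTotalOrder
  have hmap : ∀ i : Fin s, Set.WellFoundedOn {m : Fin s × (Fin n → ℕ) | m.1 = i} lt := by
    intro i
    refine Subrelation.wf (r := InvImage S.lt fun x => x.1.2) ?_ (InvImage.wf _ S.wellFounded)
    rintro ⟨⟨a, α⟩, rfl⟩ ⟨⟨b, β⟩, hb⟩ h
    simp only [Set.mem_ofPred_eq] at hb
    subst hb
    change lt (b, α) (b, β) at h
    change S.lt α β
    rcases trichotomous_of S.lt α β with h' | h' | h'
    · exact h'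
    · exact absurd (h' ▸ h) (irrefl_of lt _)
    · exact absurd (trans_of lt h (hlt.lt_of_lt _ _ b h')) (irrefl_of lt _)
  have hsup := (Finset.wellFoundedOn_sup (r := lt) (Finset.univ : Finset (Fin s))
    (f := fun i => {m : Fin s × (Fin n → ℕ) | m.1 = i})).2 fun i _ => hmap i
  have huniv : (Finset.univ : Finset (Fin s)).sup
      (fun i => {m : Fin s × (Fin n → ℕ) | m.1 = i}) = Set.univ := by
    ext m
    simp [Finset.sup_eq_iSup]
  rw [huniv] at hsup
  exact Set.wellFoundedOn_univ.1 hsup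

end FreeModule

end SolvablePolynomialAlgebra

namespace SolvablePolynomialAlgebra

variable {K A : Type*} [Field K] [Ring A] [Algebra K A] {n : ℕ}
  (S : SolvablePolynomialAlgebra K A n)

/-! ### The left division algorithm -/

section Division

variable {s t : ℕ} {lt : Fin s × (Fin n → ℕ) → Fin s × (Fin n → ℕ) → Prop}

theorem sub_smul_mem_below [IsStrictTotalOrder _ lt] {ω ζ : Fin s → A} {m : Fin s × (Fin n → ℕ)}
    {c : K} (hω : S.IsLM lt ω m) (hζ : S.IsLM lt ζ m) (hc : c = (S.lc lt ζ)⁻¹ * S.lc lt ω) :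
    ω - c • ζ ∈ S.below lt m := by
  rw [hω.lc_eq S, hζ.lc_eq S] at hc
  have h := Submodule.sub_mem _ (hω.sub_mem_below S)
    (Submodule.smul_mem _ c (hζ.sub_mem_below S))
  have hcz : c * S.coeff ζ m = S.coeff ω m := by
    rw [hc, mul_right_comm, inv_mul_cancel₀ hζ.1, one_mul]
  rw [smul_sub, smul_smul, hcz] at h
  simpa using h

theorem sub_lc_smul_mon_mem_below [IsStrictTotalOrder _ lt] {ω : Fin s → A}
    {m : Fin s × (Fin n → ℕ)} (hω : S.IsLM lt ω m) :
    ω - S.lc lt ω • S.mon m ∈ S.below lt m := by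
  rw [hω.lc_eq S]
  exact hω.sub_mem_below S

/-- No monomial of `η` is divisible by a leading monomial of a member of `G`. -/
def IsReduced (lt : Fin s × (Fin n → ℕ) → Fin s × (Fin n → ℕ) → Prop) (G : Fin t → Fin s → A)
    (η : Fin s → A) : Prop :=
  ∀ m, S.coeff η m ≠ 0 → ∀ j v, S.IsLM lt (G j) v → ∀ δ, m ≠ shift δ v

variable {G : Fin t → Fin s → A} (hlt : S.IsLeftMonomialOrder lt)

include hlt

omit hlt in
-- The loop invariant: terms only move between the quotients, the remainder and ω.
theorem DivStep.linearCombination_add {x y : DivState A s t} (h : S.DivStep lt G x y) :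
    Fintype.linearCombination A G y.q + y.η + y.ω =
      Fintype.linearCombination A G x.q + x.η + x.ω := by
  cases h with
  | reduce q η ω m u i γ c =>
    simp only [map_add, Fintype.linearCombination_apply_single, smul_assoc]
    abel
  | move q η ω m =>
    simp only
    abel

theorem DivStep.isReduced {x y : DivState A s t} (h : S.DivStep lt G x y)
    (hx : S.IsReduced lt G x.η) : S.IsReduced lt G y.η := by
  cases h with
  | reduce q η ω m u i γ c => exact hx
  | move q η ω m hω hnone =>
    intro m' hm' j v hv δ hδ
    simp only [coeff_add, coeff_smul, coeff_mon] at hm'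
    by_cases hmm : m = m'
    · subst hmm
      exact hnone j ⟨v, δ, hv, (hlt.isLM_pbw_smul_mon_iff S).2 hδ⟩
    · exact hx m' (by simpa [hmm] using hm') j v hv δ hδ

/-- If the element to be divided has only monomials smaller than `M`, then so do all the products
`a^δ g_j` for the monomials `a^δ ε_j` of the quotients. -/
theorem DivStep.quotient_lt {x y : DivState A s t} (h : S.DivStep lt G x y)
    {M : Fin s × (Fin n → ℕ)} (hω : x.ω ∈ S.below lt M)
    (hq : ∀ u, S.coeff x.q u ≠ 0 → ∃ w, S.IsLM lt (S.pbw u.2 • G u.1) w ∧ lt w M) :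
    y.ω ∈ S.below lt M ∧
      ∀ u, S.coeff y.q u ≠ 0 → ∃ w, S.IsLM lt (S.pbw u.2 • G u.1) w ∧ lt w M := by
  have := hlt.isStrictTotalOrder
  cases h with
  | reduce q η ω m u i γ c hm hu hdvd hleast hc =>
    have hGi : S.IsLM lt (S.pbw γ • G i) m := by
      rw [(hlt.isLM_pbw_smul_mon_iff S).1 hdvd]
      exact hlt.isLM_pbw_smul S γ hu
    refine ⟨S.below_mono (hω m hm.1) (S.sub_smul_mem_below hm hGi hc), fun u' hu' => ?_⟩
    simp only [coeff_add, single_smul_pbw, coeff_smul, coeff_mon] at hu'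
    by_cases h : (i, γ) = u'
    · subst h
      exact ⟨m, hGi, hω m hm.1⟩
    · exact hq u' (by simpa [h] using hu')
  | move q η ω m hm hnone =>
    exact ⟨S.below_mono (hω m hm.1) (S.sub_lc_smul_mon_mem_below hm), hq⟩

theorem DivReturns.eq_and_isReduced {ξ η : Fin s → A} {q : Fin t → A}
    (h : S.DivReturns lt G ξ q η) :
    Fintype.linearCombination A G q + η = ξ ∧ S.IsReduced lt G η := by
  suffices ∀ y, Relation.ReflTransGen (S.DivStep lt G) ⟨0, 0, ξ⟩ y →
      Fintype.linearCombination A G y.q + y.η + y.ω = ξ ∧ S.IsReduced lt G y.η by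
    simpa using this _ h
  intro y hy
  induction hy with
  | refl => exact ⟨by simp, fun m hm => absurd (by simp) hm⟩
  | tail _ hstep ih =>
    exact ⟨(hstep.linearCombination_add S).trans ih.1, hstep.isReduced S hlt ih.2⟩

theorem DivReturns.quotient_lt {ξ η : Fin s → A} {q : Fin t → A} (h : S.DivReturns lt G ξ q η)
    {M : Fin s × (Fin n → ℕ)} (hξ : ξ ∈ S.below lt M) (u) (hu : S.coeff q u ≠ 0) :
    ∃ w, S.IsLM lt (S.pbw u.2 • G u.1) w ∧ lt w M := by
  suffices ∀ y, Relation.ReflTransGen (S.DivStep lt G) ⟨0, 0, ξ⟩ y → y.ω ∈ S.below lt M ∧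
      ∀ u, S.coeff y.q u ≠ 0 → ∃ w, S.IsLM lt (S.pbw u.2 • G u.1) w ∧ lt w M from
    (this _ h).2 u hu
  intro y hy
  induction hy with
  | refl => exact ⟨hξ, fun m hm => absurd (by simp) hm⟩
  | tail _ hstep ih => exact hstep.quotient_lt S hlt ih.1 ih.2

theorem exists_divStep (q : Fin t → A) (η : Fin s → A) {ω : Fin s → A} {m : Fin s × (Fin n → ℕ)}
    (hω : S.IsLM lt ω m) : ∃ y, S.DivStep lt G ⟨q, η, ω⟩ y ∧ y.ω ∈ S.below lt m := by
  have := hlt.isStrictTotalOrder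
  by_cases h : ∃ j, ∃ (v : Fin s × (Fin n → ℕ)) (δ : Fin n → ℕ),
        S.IsLM lt (G j) v ∧ S.IsLM lt (S.pbw δ • S.mon v) m
  · obtain ⟨i, ⟨v, δ, hv, hdvd⟩, hmin⟩ := WellFounded.has_min
      (wellFounded_lt : WellFounded ((· < ·) : Fin t → Fin t → Prop)) {j | ∃ v δ,
        S.IsLM lt (G j) v ∧ S.IsLM lt (S.pbw δ • S.mon v) m} h
    refine ⟨_, DivStep.reduce q η ω m v i δ _ hω hv hdvd (fun j hj hex => hmin j hex hj) rfl, ?_⟩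
    refine S.sub_smul_mem_below hω ?_ rfl
    rw [(hlt.isLM_pbw_smul_mon_iff S).1 hdvd]
    exact hlt.isLM_pbw_smul S δ hv
  · exact ⟨_, DivStep.move q η ω m hω fun j hj => h ⟨j, hj⟩, S.sub_lc_smul_mon_mem_below hω⟩

-- Each pass strictly lowers LM(ω), so termination is well-founded induction on it.
variable (G) in
theorem exists_divReturns (ξ : Fin s → A) : ∃ q η, S.DivReturns lt G ξ q η := by
  have := hlt.isStrictTotalOrder
  suffices h : ∀ m (q : Fin t → A) (η ω : Fin s → A), S.IsLM lt ω m → ∃ q' η',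
      Relation.ReflTransGen (S.DivStep lt G) ⟨q, η, ω⟩ ⟨q', η', 0⟩ by
    by_cases h0 : ξ = 0
    · exact ⟨0, 0, by subst h0; exact Relation.ReflTransGen.refl⟩
    · obtain ⟨m, hm⟩ := S.exists_isLM (lt := lt) h0
      exact h m 0 0 ξ hm
  intro m
  induction m using (hlt.wellFounded S).induction with
  | _ m ih =>
    intro q η ω hω
    obtain ⟨⟨q', η', ω'⟩, hstep, hbelow⟩ := S.exists_divStep (G := G) hlt q η hω
    by_cases h0 : ω' = 0
    · exact ⟨q', η', Relation.ReflTransGen.single (h0 ▸ hstep)⟩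
    · obtain ⟨m', hm'⟩ := S.exists_isLM (lt := lt) h0
      obtain ⟨q'', η'', h⟩ := ih m' (hbelow m' hm'.1) q' η' ω' hm'
      exact ⟨q'', η'', h.head hstep⟩

end Division

/-! ### Left Gröbner bases and Noetherianity -/

section Groebner

variable {s t : ℕ} {lt : Fin s × (Fin n → ℕ) → Fin s × (Fin n → ℕ) → Prop}
  {G : Fin t → Fin s → A} {N : Submodule A (Fin s → A)} (hlt : S.IsLeftMonomialOrder lt)

include hlt

/-- Divisibility of leading monomials becomes translation of exponents, which already forces equal
components. -/
theorem isLeftGroebnerBasis_iff : S.IsLeftGroebnerBasis lt N G ↔ (∀ j, G j ∈ N ∧ G j ≠ 0) ∧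
    ∀ ξ ∈ N, ∀ m, S.IsLM lt ξ m → ∃ j γ u, S.IsLM lt (G j) u ∧ m = shift γ u := by
  have := hlt.isStrictTotalOrder
  refine and_congr_right fun _ => ⟨fun h ξ hξ m hm => ?_, fun h ξ hξ h0 => ?_⟩
  · obtain ⟨j, u, m', γ, hu, hm', -, hdvd⟩ := h ξ hξ (hm.ne_zero S)
    exact ⟨j, γ, u, hu, by rw [hm.unique S hm', (hlt.isLM_pbw_smul_mon_iff S).1 hdvd]⟩
  · obtain ⟨m, hm⟩ := S.exists_isLM (lt := lt) h0
    obtain ⟨j, γ, u, hu, rfl⟩ := h ξ hξ m hm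
    exact ⟨j, u, _, γ, hu, hm, rfl, hlt.isLM_pbw_smul_mon S γ u⟩

theorem IsLeftGroebnerBasis.eq_zero_of_isReduced (hG : S.IsLeftGroebnerBasis lt N G)
    {η : Fin s → A} (hη : η ∈ N) (hred : S.IsReduced lt G η) : η = 0 := by
  have := hlt.isStrictTotalOrder
  by_contra h0
  obtain ⟨m, hm⟩ := S.exists_isLM (lt := lt) h0
  obtain ⟨j, γ, u, hu, h⟩ := ((S.isLeftGroebnerBasis_iff hlt).1 hG).2 η hη m hm
  exact hred m hm.1 j u hu γ h

omit hlt in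
theorem IsLeftGroebnerBasis.linearCombination_mem (hG : S.IsLeftGroebnerBasis lt N G)
    (q : Fin t → A) : Fintype.linearCombination A G q ∈ N := by
  rw [Fintype.linearCombination_apply]
  exact Submodule.sum_mem _ fun i _ => Submodule.smul_mem _ _ (hG.1 i).1

theorem IsLeftGroebnerBasis.remainder_eq_zero (hG : S.IsLeftGroebnerBasis lt N G)
    {ξ η : Fin s → A} {q : Fin t → A} (hξ : ξ ∈ N) (h : S.DivReturns lt G ξ q η) : η = 0 := by
  obtain ⟨h1, h2⟩ := h.eq_and_isReduced S hlt
  refine hG.eq_zero_of_isReduced S hlt ?_ h2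
  rw [← eq_sub_iff_add_eq'] at h1
  rw [h1]
  exact Submodule.sub_mem _ hξ (hG.linearCombination_mem S q)

theorem IsLeftGroebnerBasis.range_linearCombination (hG : S.IsLeftGroebnerBasis lt N G) :
    LinearMap.range (Fintype.linearCombination A G) = N := by
  apply le_antisymm
  · rintro _ ⟨q, rfl⟩
    exact hG.linearCombination_mem S q
  · intro ξ hξ
    obtain ⟨q, η, h⟩ := S.exists_divReturns G hlt ξ
    have h0 := hG.remainder_eq_zero S hlt hξ h
    have h1 := (h.eq_and_isReduced S hlt).1
    exact ⟨q, by rw [← h1, h0, add_zero]⟩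

variable (N) in
theorem exists_isLeftGroebnerBasis :
    ∃ (t : ℕ) (G : Fin t → Fin s → A), S.IsLeftGroebnerBasis lt N G := by
  have := hlt.isStrictTotalOrder
  let r : Fin s × (Fin n → ℕ) → Fin s × (Fin n → ℕ) → Prop := fun u m => u.1 = m.1 ∧ u.2 ≤ m.2
  -- Dickson's lemma: divisibility of monomials is a well-quasi-order, so the minimal leading
  -- monomials, being an antichain, are finitely many.
  have hwqo : WellQuasiOrdered r :=
    WellQuasiOrdered.prod (r := (· = ·)) (Finite.wellQuasiOrdered _) wellQuasiOrdered_le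
  let T : Set (Fin s × (Fin n → ℕ)) := {m | ∃ ξ ∈ N, S.IsLM lt ξ m}
  let T₀ : Set (Fin s × (Fin n → ℕ)) := {m | m ∈ T ∧ ∀ u ∈ T, r u m → u = m}
  have hfin : T₀.Finite := by
    refine IsAntichain.finite_of_wellQuasiOrdered (r := r) ?_ hwqo
    intro u hu m hm hne h
    exact hne (hm.2 u hu.1 h)
  have hex : ∀ m ∈ T, ∃ u ∈ T₀, r u m := by
    intro m
    induction m using (hlt.wellFounded S).induction with
    | _ m ih =>
      intro hm
      by_cases h : m ∈ T₀
      · exact ⟨m, h, rfl, le_rfl⟩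
      · have : ∃ u ∈ T, r u m ∧ u ≠ m := by
          by_contra! h'
          exact h ⟨hm, h'⟩
        obtain ⟨u, hu, hum, hne⟩ := this
        -- Proper divisors are smaller in the monomial ordering, which makes the induction descend
        -- to a minimal divisor.
        have hltum : lt u m := by
          obtain ⟨i, α⟩ := u
          obtain ⟨j, β⟩ := m
          obtain ⟨rfl, hle⟩ : i = j ∧ α ≤ β := hum
          rcases S.le_of_pointwise_le hle with rfl | h
          · exact absurd rfl hne
          · exact hlt.lt_of_lt _ _ _ h
        obtain ⟨v, hv, hvu⟩ := ih u hltum hu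
        exact ⟨v, hv, hvu.1.trans hum.1, hvu.2.trans hum.2⟩
  have := hfin.fintype
  let e := Fintype.equivFin T₀
  choose g hgN hgLM using fun m : T₀ => m.2.1
  refine ⟨_, fun j => g (e.symm j), (S.isLeftGroebnerBasis_iff hlt).2
    ⟨fun j => ⟨hgN _, (hgLM _).ne_zero S⟩, fun ξ hξ m hm => ?_⟩⟩
  obtain ⟨u, hu, hr⟩ := hex m ⟨ξ, hξ, hm⟩
  obtain ⟨γ, hγ⟩ := exists_eq_shift_iff.2 hr
  exact ⟨e ⟨u, hu⟩, γ, u, by simpa using hgLM ⟨u, hu⟩, hγ⟩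

end Groebner

theorem isLeftMonomialOrder_lex (s : ℕ) :
    S.IsLeftMonomialOrder (s := s) (Prod.Lex (· < ·) S.lt) := by
  have : IsStrictTotalOrder (Fin s × (Fin n → ℕ)) (Prod.Lex (· < ·) S.lt) := {}
  refine S.isLeftMonomialOrder_of_shift_lt (fun α β i h => Prod.Lex.right _ h) ?_
  rintro γ ⟨i, α⟩ ⟨j, β⟩ h
  rw [Prod.lex_def] at h ⊢
  exact h.imp id fun ⟨h1, h2⟩ => ⟨h1, S.add_lt_add_left γ h2⟩

include S in
theorem isNoetherian_pi (s : ℕ) : IsNoetherian A (Fin s → A) := by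
  refine ⟨fun N => ?_⟩
  obtain ⟨t, G, hG⟩ := S.exists_isLeftGroebnerBasis N (S.isLeftMonomialOrder_lex s)
  rw [← hG.range_linearCombination S (S.isLeftMonomialOrder_lex s), Fintype.range_linearCombination]
  exact Submodule.fg_span (Set.finite_range G)

-- This also yields invariant basis number, so both the existence and the uniqueness of the rank of
-- P rest on A being left Noetherian.
include S in
theorem strongRankCondition : StrongRankCondition A := by
  have := S.nontrivial
  have := S.isNoetherian_pi 1
  have : IsNoetherianRing A := isNoetherian_of_linearEquiv (LinearEquiv.funUnique (Fin 1) A A)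
  infer_instance

end SolvablePolynomialAlgebra

namespace SolvablePolynomialAlgebra

variable {K A : Type*} [Field K] [Ring A] [Algebra K A] {n : ℕ}
  (S : SolvablePolynomialAlgebra K A n)

/-! ### The Schreyer ordering and syzygies of a Gröbner basis -/

section Schreyer

variable {s t : ℕ} {lt : Fin s × (Fin n → ℕ) → Fin s × (Fin n → ℕ) → Prop}
  {G : Fin t → Fin s → A} {ℓ : Fin t → Fin s × (Fin n → ℕ)} (hlt : S.IsLeftMonomialOrder lt)
  (hℓ : ∀ j, S.IsLM lt (G j) (ℓ j))

include hlt hℓ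

theorem schreyerLt_iff (x y : Fin t × (Fin n → ℕ)) : S.schreyerLt lt G x y ↔
    lt (shift x.2 (ℓ x.1)) (shift y.2 (ℓ y.1)) ∨
      (shift x.2 (ℓ x.1) = shift y.2 (ℓ y.1) ∧ x.1 < y.1) := by
  have := hlt.isStrictTotalOrder
  constructor
  · rintro ⟨u, v, hu, hv, h⟩
    rwa [hu.unique S (hlt.isLM_pbw_smul S _ (hℓ _)),
      hv.unique S (hlt.isLM_pbw_smul S _ (hℓ _))] at h
  · exact fun h => ⟨_, _, hlt.isLM_pbw_smul S _ (hℓ _), hlt.isLM_pbw_smul S _ (hℓ _), h⟩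

theorem isLeftMonomialOrder_schreyerLt : S.IsLeftMonomialOrder (S.schreyerLt lt G) := by
  have := hlt.isStrictTotalOrder
  have hiff := S.schreyerLt_iff hlt hℓ
  have : IsStrictTotalOrder _ (S.schreyerLt lt G) :=
    { trichotomous := by
        intro x y hxy hyx
        rw [hiff, not_or, not_and] at hxy hyx
        -- Incomparable monomials have equal images and, by the tie-break, equal index; cancelling
        -- the common exponent makes them equal.
        have h := (trichotomous_of lt _ _).resolve_left hxy.1 |>.resolve_right hyx.1
        have h1 : x.1 = y.1 := le_antisymm (not_lt.1 (hyx.2 h.symm)) (not_lt.1 (hxy.2 h))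
        rw [h1] at h
        exact Prod.ext h1 (shift_injective_left h)
      irrefl := by
        intro x h
        rw [hiff] at h
        exact h.elim (irrefl_of lt _) fun h => lt_irrefl _ h.2
      trans := by
        intro x y z hxy hyz
        rw [hiff] at hxy hyz ⊢
        rcases hxy with hxy | ⟨hxy, hxy'⟩ <;> rcases hyz with hyz | ⟨hyz, hyz'⟩
        · exact Or.inl (trans_of lt hxy hyz)
        · exact Or.inl (hyz ▸ hxy)
        · exact Or.inl (hxy ▸ hyz)
        · exact Or.inr ⟨hxy.trans hyz, hxy'.trans hyz'⟩ }
  refine S.isLeftMonomialOrder_of_shift_lt (fun α β i h => ?_) fun γ u v h => ?_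
  · rw [hiff]
    have h' := hlt.lt_of_lt _ _ (ℓ i).1 (S.add_lt_add_left (ℓ i).2 h)
    rw [add_comm _ α, add_comm _ β] at h'
    exact Or.inl h'
  · rw [hiff] at h ⊢
    simp only [shift_fst, shift_snd, ← shift_shift]
    exact h.imp (hlt.shift_lt S γ) fun h => ⟨by rw [h.1], h.2⟩

theorem normalizer_smul_sub_mem_below (δ : Fin n → ℕ) (j : Fin t) :
    S.normalizer lt δ (G j) • G j - S.mon (shift δ (ℓ j)) ∈ S.below lt (shift δ (ℓ j)) := by
  have := hlt.isStrictTotalOrder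
  have h := hlt.isLM_pbw_smul S δ (hℓ j)
  have h' := Submodule.smul_mem _ (S.lc lt (S.pbw δ • G j))⁻¹ (h.sub_mem_below S)
  rwa [smul_sub, smul_smul, h.lc_eq S, inv_mul_cancel₀ h.1, one_smul, ← smul_assoc,
    ← h.lc_eq S] at h'

theorem exists_normalizer_eq (δ : Fin n → ℕ) (j : Fin t) :
    ∃ c : K, c ≠ 0 ∧ S.normalizer lt δ (G j) = c • S.pbw δ := by
  have := hlt.isStrictTotalOrder
  have h := hlt.isLM_pbw_smul S δ (hℓ j)
  exact ⟨_, inv_ne_zero (by rw [h.lc_eq S]; exact h.1), rfl⟩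

theorem exists_isSyzygy {i j : Fin t} (hij : (ℓ i).1 = (ℓ j).1) :
    ∃ h, S.IsSyzygy lt G i j h := by
  have hi := hℓ i
  have hj := hℓ j
  obtain ⟨q, η, h⟩ := S.exists_divReturns G hlt
    (S.normalizer lt ((ℓ i).2 ⊔ (ℓ j).2 - (ℓ i).2) (G i) • G i -
      S.normalizer lt ((ℓ i).2 ⊔ (ℓ j).2 - (ℓ j).2) (G j) • G j)
  refine ⟨_, (ℓ i).1, (ℓ i).2, (ℓ j).2, q, η, hi, ?_, h, rfl⟩
  rw [hij]
  exact hj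

/-- Both normalized multiples lead with a^max(α,β) e_k with coefficient 1, so their difference lies
strictly below it, and so do all products occurring in its division. The ε_i and ε_j terms tie under
LM, and i < j lets ε_j win. -/
theorem IsSyzygy.isLM {i j : Fin t} (hij : i < j) {h : Fin t → A} (hh : S.IsSyzygy lt G i j h) :
    (ℓ i).1 = (ℓ j).1 ∧
      S.IsLM (S.schreyerLt lt G) h (j, (ℓ i).2 ⊔ (ℓ j).2 - (ℓ j).2) := by
  have := hlt.isStrictTotalOrder
  have hS := S.isLeftMonomialOrder_schreyerLt hlt hℓ
  have := hS.isStrictTotalOrder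
  have hiff := S.schreyerLt_iff hlt hℓ
  obtain ⟨k, α, β, q, η, hi, hj, hdiv, rfl⟩ := hh
  have hℓi : ℓ i = (k, α) := (hℓ i).unique S hi
  have hℓj : ℓ j = (k, β) := (hℓ j).unique S hj
  rw [hℓi, hℓj]
  refine ⟨rfl, ?_⟩
  simp only
  have hsi : shift (α ⊔ β - α) (ℓ i) = (k, α ⊔ β) := by
    rw [hℓi, shift, tsub_add_cancel_of_le le_sup_left]
  have hsj : shift (α ⊔ β - β) (ℓ j) = (k, α ⊔ β) := by
    rw [hℓj, shift, tsub_add_cancel_of_le le_sup_right]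
  have hbelow := Submodule.sub_mem _
    (hsi ▸ S.normalizer_smul_sub_mem_below hlt hℓ (α ⊔ β - α) i)
    (hsj ▸ S.normalizer_smul_sub_mem_below hlt hℓ (α ⊔ β - β) j)
  rw [sub_sub_sub_cancel_right] at hbelow
  have hq : q ∈ S.below (S.schreyerLt lt G) (j, α ⊔ β - β) := by
    intro u hu
    obtain ⟨w, hw, hwlt⟩ := hdiv.quotient_lt S hlt hbelow u hu
    rw [hiff]
    left
    rw [hsj, ← hw.unique S (hlt.isLM_pbw_smul S u.2 (hℓ u.1))]
    exact hwlt
  obtain ⟨a, -, ha⟩ := S.exists_normalizer_eq hlt hℓ (α ⊔ β - α) i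
  obtain ⟨b, hb, hb'⟩ := S.exists_normalizer_eq hlt hℓ (α ⊔ β - β) j
  rw [ha, hb', single_smul_pbw, single_smul_pbw]
  refine S.isLM_of_sub_mem_below hb ?_
  rw [add_sub_cancel_right]
  refine Submodule.sub_mem _ hq (Submodule.smul_mem _ _ (S.mon_mem_below ?_))
  rw [hiff]
  exact Or.inr ⟨hsi.trans hsj.symm, hij⟩

variable {N : Submodule A (Fin s → A)} (hG : S.IsLeftGroebnerBasis lt N G)

include hG in
omit hℓ in
theorem IsSyzygy.mem_ker {i j : Fin t} {h : Fin t → A} (hh : S.IsSyzygy lt G i j h) :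
    h ∈ LinearMap.ker (Fintype.linearCombination A G) := by
  obtain ⟨k, α, β, q, η, hi, hj, hdiv, rfl⟩ := hh
  have hη := hG.remainder_eq_zero S hlt (Submodule.sub_mem _ (Submodule.smul_mem _ _ (hG.1 i).1)
    (Submodule.smul_mem _ _ (hG.1 j).1)) hdiv
  have hsum := (hdiv.eq_and_isReduced S hlt).1
  rw [hη, add_zero] at hsum
  rw [LinearMap.mem_ker, map_add, map_sub, hsum, Fintype.linearCombination_apply_single,
    Fintype.linearCombination_apply_single]
  abel

/-- The leading monomial of a syzygy of `G`, with respect to the Schreyer ordering, is cancelled by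
another monomial of the syzygy. -/
theorem exists_shift_eq_of_mem_ker {ξ : Fin t → A}
    (hξ : ξ ∈ LinearMap.ker (Fintype.linearCombination A G)) {m : Fin t × (Fin n → ℕ)}
    (hm : S.IsLM (S.schreyerLt lt G) ξ m) :
    ∃ i δ, i < m.1 ∧ shift δ (ℓ i) = shift m.2 (ℓ m.1) := by
  have := hlt.isStrictTotalOrder
  have hiff := S.schreyerLt_iff hlt hℓ
  -- Without a tie at a smaller index, every other monomial of ξ maps strictly below the image of m,
  -- so the coefficient there cannot cancel.
  by_contra! hne
  have hlin : ∀ u : Fin t × (Fin n → ℕ),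
      Fintype.linearCombination A G (S.coeff ξ u • S.mon u) = S.coeff ξ u • S.pbw u.2 • G u.1 := by
    intro u
    rw [← single_smul_pbw, Fintype.linearCombination_apply_single, smul_assoc]
  have hrest : Fintype.linearCombination A G (ξ - S.coeff ξ m • S.mon m) ∈
      S.below lt (shift m.2 (ℓ m.1)) := by
    have hsub := hm.sub_mem_below S
    rw [← S.sum_coeff_smul_mon (ξ - S.coeff ξ m • S.mon m), map_sum]
    refine Submodule.sum_mem _ fun u hu => ?_
    have hu' := hsub u (by simpa using hu)
    rw [← single_smul_pbw, Fintype.linearCombination_apply_single, smul_assoc]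
    refine Submodule.smul_mem _ _ ?_
    have hult : lt (shift u.2 (ℓ u.1)) (shift m.2 (ℓ m.1)) := by
      rcases (hiff _ _).1 hu' with h | ⟨h, h'⟩
      · exact h
      · exact absurd h (hne _ _ h')
    have hLM := hlt.isLM_pbw_smul S u.2 (hℓ u.1)
    have := Submodule.add_mem _ (S.below_mono hult (hLM.sub_mem_below S))
      (Submodule.smul_mem _ (S.coeff (S.pbw u.2 • G u.1) (shift u.2 (ℓ u.1)))
        (S.mon_mem_below hult))
    rwa [sub_add_cancel] at this
  rw [map_sub, LinearMap.mem_ker.1 hξ, hlin, zero_sub] at hrest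
  have hLM := hlt.isLM_pbw_smul S m.2 (hℓ m.1)
  refine irrefl_of lt _ (hrest _ ?_)
  rw [← neg_one_smul K, coeff_smul, coeff_smul]
  exact mul_ne_zero (neg_ne_zero.2 one_ne_zero) (mul_ne_zero hm.1 hLM.1)

include hG in
/-- Schreyer's theorem: the syzygies `s_ij` form a left Gröbner basis of the syzygy module. -/
theorem isLeftGroebnerBasis_syzygies {r : ℕ} {H : Fin r → Fin t → A}
    (e : Fin r ≃ S.CriticalPair lt G)
    (hH : ∀ l, S.IsSyzygy lt G (e l).1.1 (e l).1.2 (H l)) :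
    S.IsLeftGroebnerBasis (S.schreyerLt lt G)
      (LinearMap.ker (Fintype.linearCombination A G)) H := by
  have hS := S.isLeftMonomialOrder_schreyerLt hlt hℓ
  have hLM := fun l => (hH l).isLM S hlt hℓ (e l).2.1
  refine (S.isLeftGroebnerBasis_iff hS).2
    ⟨fun l => ⟨(hH l).mem_ker S hlt hG, (hLM l).2.ne_zero S⟩, fun ξ hξ m hm => ?_⟩
  obtain ⟨i, δ, hi, heq⟩ := S.exists_shift_eq_of_mem_ker hlt hℓ hξ hm
  obtain ⟨j, γ⟩ := m
  simp only [shift, Prod.mk.injEq] at hi heq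
  have hLi := hℓ i
  have hLj := hℓ j
  let p : S.CriticalPair lt G := ⟨(i, j), hi, (ℓ i).1, (ℓ i).2, (ℓ j).2, hLi, by
    rw [heq.1]; exact hLj⟩
  obtain ⟨l, hl⟩ := e.surjective p
  have h1 := (hLM l).2
  have h2 : (e l).1 = (i, j) := by rw [hl]
  rw [h2] at h1
  -- The tie makes γ plus the exponent of LM(g_j) a common multiple of both exponents, hence at
  -- least their maximum.
  obtain ⟨μ, hμ⟩ := exists_eq_shift_iff (u := (j, (ℓ i).2 ⊔ (ℓ j).2 - (ℓ j).2)) (m := (j, γ)) |>.2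
    ⟨rfl, tsub_le_iff_right.2 (sup_le (heq.2 ▸ le_add_self) le_add_self)⟩
  exact ⟨l, μ, _, h1, hμ⟩

/-- The variables eliminated from the leading monomials by the syzygies of a lexicographically
sorted family. -/
theorem IsSyzygy.leading_exponent_eq_zero (hsort : S.IsLexSorted lt G) {k : ℕ}
    (hk : ∀ j (a : Fin n), (a : ℕ) < k → (ℓ j).2 a = 0) {i j : Fin t} (hij : i < j)
    {h : Fin t → A} (hh : S.IsSyzygy lt G i j h) {m : Fin t × (Fin n → ℕ)}
    (hm : S.IsLM (S.schreyerLt lt G) h m) (a : Fin n) (ha : (a : ℕ) < k + 1) : m.2 a = 0 := by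
  have := (S.isLeftMonomialOrder_schreyerLt hlt hℓ).isStrictTotalOrder
  obtain ⟨hcomp, hLM⟩ := hh.isLM S hlt hℓ hij
  rw [hm.unique S hLM]
  have hle : toLex (ℓ i).2 ≤ toLex (ℓ j).2 := by
    have hi := hℓ i
    have hj := hℓ j
    refine hsort i j (ℓ i).1 _ _ hij hi ?_
    rw [hcomp]
    exact hj
  -- The first coordinate b where the exponents differ cannot precede a: it would be one of the
  -- first k, where both exponents vanish.
  have key : (ℓ i).2 a ≤ (ℓ j).2 a := by
    rcases hle.eq_or_lt with h | ⟨b, hb, hlt'⟩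
    · exact (congrFun (toLex.injective h) a).le
    · rcases lt_trichotomy a b with hab | rfl | hab
      · exact (hb a hab).le
      · exact le_of_lt hlt'
      · have hbk : (b : ℕ) < k := by
          have : (b : ℕ) < a := hab
          omega
        have h0 := hk j b hbk
        change (ℓ i).2 b < (ℓ j).2 b at hlt'
        omega
  simp [key]

end Schreyer

end SolvablePolynomialAlgebra

/-! ### Splitting resolutions and the rank of a stably free module -/

section StablyFree

variable {A : Type*} [Ring A]

theorem LinearMap.nonempty_equiv_ker_prod {L Q : Type*} [AddCommGroup L] [Module A L]
    [AddCommGroup Q] [Module A Q] [Module.Projective A L] [Module.Projective A Q] (f : L →ₗ[A] Q)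
    (hf : Function.Surjective f) :
    Nonempty (L ≃ₗ[A] LinearMap.ker f × Q) ∧ Module.Projective A (LinearMap.ker f) := by
  obtain ⟨g, hg⟩ := Module.projective_lifting_property f LinearMap.id hf
  obtain ⟨e, he, -⟩ := (LinearMap.exact_subtype_ker_map f).splitSurjectiveEquiv
    (LinearMap.ker f).injective_subtype ⟨g, hg⟩
  refine ⟨⟨e⟩, Module.Projective.of_split (LinearMap.ker f).subtype
    (LinearMap.fst A _ _ ∘ₗ e.toLinearMap) ?_⟩
  rw [he]
  ext x
  simp

section IsCompl

variable {F L Q : Type*} [AddCommGroup F] [Module A F] [AddCommGroup L] [Module A L]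
  [AddCommGroup Q] [Module A Q] (φ : L →ₗ[A] Q) {ι : F →ₗ[A] L}

theorem LinearMap.ker_comp_eq_bot_of_isCompl (hι : Function.Injective ι)
    (h : IsCompl (LinearMap.ker φ) (LinearMap.range ι)) : LinearMap.ker (φ ∘ₗ ι) = ⊥ := by
  rw [LinearMap.ker_eq_bot']
  intro x hx
  have : ι x ∈ LinearMap.ker φ ⊓ LinearMap.range ι := ⟨hx, x, rfl⟩
  rw [h.inf_eq_bot, Submodule.mem_bot] at this
  exact hι (this.trans (map_zero ι).symm)

theorem LinearMap.range_comp_eq_of_isCompl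
    (h : IsCompl (LinearMap.ker φ) (LinearMap.range ι)) :
    LinearMap.range (φ ∘ₗ ι) = LinearMap.range φ := by
  refine le_antisymm (LinearMap.range_comp_le_range ι φ) ?_
  rintro _ ⟨x, rfl⟩
  obtain ⟨y, hy, z, ⟨w, rfl⟩, rfl⟩ := Submodule.mem_sup.1
    (h.sup_eq_top ▸ Submodule.mem_top : x ∈ LinearMap.ker φ ⊔ LinearMap.range ι)
  rw [LinearMap.mem_ker] at hy
  exact ⟨w, by simp [hy]⟩

end IsCompl

/-- `A^(a+b) ≅ A^a ⊕ A^b`. -/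
def finAddFunLinearEquiv (A : Type*) [Ring A] (a b : ℕ) :
    (Fin (a + b) → A) ≃ₗ[A] (Fin a → A) × (Fin b → A) :=
  LinearEquiv.funCongrLeft A A finSumFinEquiv ≪≫ₗ
    LinearEquiv.sumArrowLequivProdArrow (Fin a) (Fin b) A A

variable {P : Type*} [AddCommGroup P] [Module A P]

namespace FreeSequence

/-- Induction on length, splitting each new module as the new kernel plus the old one. Here b and a
add up the ranks in even and odd degrees; the kernel changes sides with the parity, so no
cancellation of modules is needed. -/
theorem IsExact.exists_equiv [Module.Projective A P] {r : ℕ} {C : FreeSequence A P r}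
    (hC : C.IsExact) : Module.Projective A C.kerLast ∧ ∃ a b : ℕ, (b : ℤ) - a = C.altRank ∧
      ((Even C.length ∧ Nonempty ((P × C.kerLast × (Fin a → A)) ≃ₗ[A] (Fin b → A))) ∨
        (Odd C.length ∧ Nonempty ((P × (Fin a → A)) ≃ₗ[A] C.kerLast × (Fin b → A)))) := by
  induction C with
  | @base r φ =>
    obtain ⟨⟨e⟩, hp⟩ := LinearMap.nonempty_equiv_ker_prod φ hC
    refine ⟨hp, 0, r, by simp [altRank], Or.inl ⟨by simp [length], ⟨?_⟩⟩⟩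
    exact LinearEquiv.prodCongr (.refl A P) LinearEquiv.prodUnique ≪≫ₗ
      LinearEquiv.prodComm A _ _ ≪≫ₗ e.symm
  | @snoc r r' C φ ih =>
    obtain ⟨hC, hφ⟩ := hC
    obtain ⟨hproj, a, b, hab, h⟩ := ih hC
    have hmem : ∀ x, φ x ∈ C.kerLast := fun x => hφ ▸ ⟨x, rfl⟩
    obtain ⟨⟨e⟩, hp⟩ := LinearMap.nonempty_equiv_ker_prod (φ.codRestrict C.kerLast hmem) (by
      rintro ⟨y, hy⟩
      rw [← hφ] at hy
      obtain ⟨x, rfl⟩ := hy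
      exact ⟨x, rfl⟩)
    rw [LinearMap.ker_codRestrict] at e hp
    refine ⟨hp, ?_⟩
    rcases h with ⟨hlen, ⟨f⟩⟩ | ⟨hlen, ⟨f⟩⟩
    · refine ⟨a + r', b, ?_, Or.inr ⟨hlen.add_one, ⟨?_⟩⟩⟩
      · rw [altRank, hlen.add_one.neg_one_pow, ← hab]
        push_cast
        ring
      · let g : (P × (Fin a → A) × LinearMap.ker φ × C.kerLast) ≃ₗ[A]
            LinearMap.ker φ × P × C.kerLast × (Fin a → A) :=
          { toFun := fun x => (x.2.2.1, x.1, x.2.2.2, x.2.1)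
            invFun := fun x => (x.2.1, x.2.2.2, x.1, x.2.2.1)
            map_add' := fun _ _ => rfl
            map_smul' := fun _ _ => rfl }
        exact LinearEquiv.prodCongr (.refl A P) (finAddFunLinearEquiv A a r' ≪≫ₗ
          LinearEquiv.prodCongr (.refl A _) e) ≪≫ₗ g ≪≫ₗ LinearEquiv.prodCongr (.refl A _) f
    · refine ⟨a, r' + b, ?_, Or.inl ⟨hlen.add_one, ⟨?_⟩⟩⟩
      · rw [altRank, hlen.add_one.neg_one_pow, ← hab]
        push_cast
        ring
      · let g : (P × LinearMap.ker φ × (Fin a → A)) ≃ₗ[A]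
            LinearMap.ker φ × P × (Fin a → A) :=
          { toFun := fun x => (x.2.1, x.1, x.2.2)
            invFun := fun x => (x.2.1, x.1, x.2.2)
            map_add' := fun _ _ => rfl
            map_smul' := fun _ _ => rfl }
        exact g ≪≫ₗ LinearEquiv.prodCongr (.refl A _) f ≪≫ₗ (LinearEquiv.prodAssoc A _ _ _).symm ≪≫ₗ
          LinearEquiv.prodCongr e.symm (.refl A _) ≪≫ₗ (finAddFunLinearEquiv A r' b).symm

theorem IsFiniteFreeResolution.exists_equiv [Module.Projective A P] {r : ℕ}
    {C : FreeSequence A P r} (hC : C.IsFiniteFreeResolution) :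
    ∃ a b : ℕ, (b : ℤ) - a = C.altRank ∧
      Nonempty ((P × (Fin a → A)) ≃ₗ[A] (Fin b → A)) := by
  obtain ⟨-, a, b, hab, h⟩ := hC.1.exists_equiv
  have : Subsingleton C.kerLast := by
    rw [hC.2]
    infer_instance
  have := Unique.mk' C.kerLast
  refine ⟨a, b, hab, ?_⟩
  rcases h with ⟨-, ⟨f⟩⟩ | ⟨-, ⟨f⟩⟩
  · exact ⟨LinearEquiv.prodCongr (.refl A P) LinearEquiv.uniqueProd.symm ≪≫ₗ f⟩
  · exact ⟨f ≪≫ₗ LinearEquiv.uniqueProd⟩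

theorem isFiniteFreeResolution_precomp {r r' : ℕ} {C : FreeSequence A P r} (hC : C.IsExact)
    {ι : (Fin r' → A) →ₗ[A] (Fin r → A)} (hι : Function.Injective ι)
    (h : IsCompl C.kerLast (LinearMap.range ι)) : (C.precomp ι).IsFiniteFreeResolution := by
  cases C with
  | base φ =>
    refine ⟨?_, φ.ker_comp_eq_bot_of_isCompl hι h⟩
    change Function.Surjective (φ ∘ₗ ι)
    rw [← LinearMap.range_eq_top, φ.range_comp_eq_of_isCompl h]
    exact LinearMap.range_eq_top.2 hC
  | snoc C φ =>
    exact ⟨⟨hC.1, (φ.range_comp_eq_of_isCompl h).trans hC.2⟩, φ.ker_comp_eq_bot_of_isCompl hι h⟩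

theorem length_precomp {r r' : ℕ} (C : FreeSequence A P r)
    (ι : (Fin r' → A) →ₗ[A] (Fin r → A)) : (C.precomp ι).length = C.length := by
  cases C <;> rfl

end FreeSequence

theorem isStablyFreeOfRank_of_equiv [StrongRankCondition A] {a b : ℕ}
    (e : (P × (Fin a → A)) ≃ₗ[A] (Fin b → A)) :
    ∃ t : ℕ, (t : ℤ) = b - a ∧ IsStablyFreeOfRank A P t := by
  have hab : a ≤ b := le_of_fin_injective A (e.toLinearMap ∘ₗ LinearMap.inr A P (Fin a → A))
    (e.injective.comp LinearMap.inr_injective)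
  obtain ⟨t, rfl⟩ := Nat.exists_eq_add_of_le hab
  exact ⟨t, by push_cast; ring, a, ⟨e⟩⟩

/-- Adding A^a to one isomorphism and A^s to the other gives A^(s+t+a) ≅ A^(b+s). -/
theorem IsStablyFreeOfRank.eq_sub_of_equiv [InvariantBasisNumber A] {t a b : ℕ}
    (h : IsStablyFreeOfRank A P t) (e : (P × (Fin a → A)) ≃ₗ[A] (Fin b → A)) :
    (t : ℤ) = b - a := by
  obtain ⟨s, ⟨f⟩⟩ := h
  let g : ((P × (Fin s → A)) × (Fin a → A)) ≃ₗ[A] (P × (Fin a → A)) × (Fin s → A) :=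
    { toFun := fun x => ((x.1.1, x.2), x.1.2)
      invFun := fun x => ((x.1.1, x.2), x.1.2)
      map_add' := fun _ _ => rfl
      map_smul' := fun _ _ => rfl }
  have := eq_of_fin_equiv A (finAddFunLinearEquiv A (s + t) a ≪≫ₗ
    LinearEquiv.prodCongr f.symm (.refl A _) ≪≫ₗ g ≪≫ₗ
    LinearEquiv.prodCongr e (.refl A _) ≪≫ₗ (finAddFunLinearEquiv A b s).symm)
  omega

end StablyFree

/-! ### Correctness and termination of Algorithm-FRES -/

namespace SolvablePolynomialAlgebra

variable {K A : Type*} [Field K] [Ring A] [Algebra K A] {n : ℕ}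
  (S : SolvablePolynomialAlgebra K A n) {M : Type*} [AddCommGroup M] [Module A M]

/-- What holds for the state of the resolution algorithm after `k` passes through the loop: the
sequence is exact of length `k`, the current family is a left Gröbner basis of the last kernel, and
the variables `a₁, …, a_k` do not occur in its leading monomials. -/
structure FRESInvariant (k : ℕ) (x : FRESState n A M) : Prop where
  isExact : x.seq.IsExact
  length_eq : x.seq.length = k
  isLeftMonomialOrder : S.IsLeftMonomialOrder x.lt
  isLeftGroebnerBasis : S.IsLeftGroebnerBasis x.lt x.seq.kerLast x.gb
  leading_exponent_eq_zero : ∀ (j : Fin x.card) (m : Fin x.rank × (Fin n → ℕ)),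
    S.IsLM x.lt (x.gb j) m → ∀ a : Fin n, (a : ℕ) < k → m.2 a = 0

variable {S}

theorem FRESInvariant.stops {k : ℕ} {x : FRESState n A M} (hx : S.FRESInvariant k x)
    (hk : n ≤ k) : S.FRESStops x :=
  fun j m hm => funext fun a => hx.leading_exponent_eq_zero j m hm a (a.2.trans_le hk)

theorem IsLeftGroebnerBasis.comp_perm {s t : ℕ}
    {lt : Fin s × (Fin n → ℕ) → Fin s × (Fin n → ℕ) → Prop} {N : Submodule A (Fin s → A)}
    {G : Fin t → Fin s → A} (hG : S.IsLeftGroebnerBasis lt N G) (σ : Equiv.Perm (Fin t)) :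
    S.IsLeftGroebnerBasis lt N (G ∘ σ) := by
  refine ⟨fun j => hG.1 (σ j), fun ξ hξ h0 => ?_⟩
  obtain ⟨j, u, m, γ, h⟩ := hG.2 ξ hξ h0
  exact ⟨σ.symm j, u, m, γ, by simpa using h⟩

theorem FRESInvariant.step {k : ℕ} {x y : FRESState n A M} (hx : S.FRESInvariant k x)
    (h : S.FRESStep x y) : S.FRESInvariant (k + 1) y := by
  cases h with
  | mk C lt G G' H hgo σ hG' hsort e hH =>
    obtain ⟨hexact, hlen, hlt, hgb, hzero⟩ := hx
    simp only at hexact hlen hlt hgb hzero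
    have := hlt.isStrictTotalOrder
    subst hG'
    have hgb' := hgb.comp_perm σ
    choose ℓ hℓ using fun j => S.exists_isLM (lt := lt) (hgb'.1 j).2
    exact
      { isExact := ⟨hexact, hgb'.range_linearCombination S hlt⟩
        length_eq := congrArg (· + 1) hlen
        isLeftMonomialOrder := S.isLeftMonomialOrder_schreyerLt hlt hℓ
        isLeftGroebnerBasis := S.isLeftGroebnerBasis_syzygies hlt hℓ hgb' e hH
        leading_exponent_eq_zero := fun l m hm =>
          (hH l).leading_exponent_eq_zero S hlt hℓ hsort
            (fun j => hzero (σ j) (ℓ j) (hℓ j)) (e l).2.1 hm }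

theorem FRESInvariant.exists_step {k : ℕ} {x : FRESState n A M} (hx : S.FRESInvariant k x)
    (hgo : ¬ S.FRESStops x) : ∃ y, S.FRESStep x y := by
  obtain ⟨s, C, lt, t, G⟩ := x
  obtain ⟨-, -, hlt, hgb, -⟩ := hx
  simp only at hlt hgb
  have := hlt.isStrictTotalOrder
  choose ℓ hℓ using fun j => S.exists_isLM (lt := lt) (hgb.1 j).2
  -- Sorting all exponents lexicographically, regardless of component, is more than is required.
  let σ := Tuple.sort fun j => toLex (ℓ j).2
  have hσ : Monotone ((fun j => toLex (ℓ j).2) ∘ σ) := Tuple.monotone_sort _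
  have hℓ' : ∀ j, S.IsLM lt ((G ∘ σ) j) (ℓ (σ j)) := fun j => hℓ (σ j)
  have : Finite (S.CriticalPair lt (G ∘ σ)) := by
    unfold CriticalPair
    infer_instance
  obtain ⟨r, ⟨e⟩⟩ := Finite.exists_equiv_fin (S.CriticalPair lt (G ∘ σ))
  have hsyz : ∀ p : S.CriticalPair lt (G ∘ σ), ∃ h, S.IsSyzygy lt (G ∘ σ) p.1.1 p.1.2 h := by
    rintro ⟨⟨i, j⟩, -, k, α, β, hi, hj⟩
    refine S.exists_isSyzygy hlt hℓ' ?_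
    rw [(hℓ' i).unique S hi, (hℓ' j).unique S hj]
  choose h hh using hsyz
  refine ⟨_, FRESStep.mk C lt G (G ∘ σ) (fun l => h (e.symm l)) hgo σ rfl ?_ e.symm
    fun l => hh _⟩
  intro i j k α β hij hi hj
  have := hσ hij.le
  simp only [Function.comp_apply] at this
  rwa [(hℓ' i).unique S hi, (hℓ' j).unique S hj] at this

theorem FRESStops.exists_returns {x : FRESState n A M} (hx : S.FRESStops x) :
    ∃ (d : ℕ) (R : FreeSequence A M d), S.FRESReturns x R := by
  obtain ⟨d, ⟨e⟩⟩ := Finite.exists_equiv_fin {k : Fin x.rank // ∀ j, ¬ S.IsLM x.lt (x.gb j) (k, 0)}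
  exact ⟨d, _, hx, e.symm, rfl⟩

/-- The last kernel and F are complementary: a nonzero element of the kernel has its leading
monomial in a component killed in F, while division by the Gröbner basis leaves a remainder in F. -/
theorem FRESInvariant.isFiniteFreeResolution {k : ℕ} {x : FRESState n A M}
    (hx : S.FRESInvariant k x) {d : ℕ} {R : FreeSequence A M d} (hR : S.FRESReturns x R) :
    R.IsFiniteFreeResolution ∧ R.length = k := by
  obtain ⟨hdone, e, rfl⟩ := hR
  have hlt := hx.isLeftMonomialOrder
  have := hlt.isStrictTotalOrder
  set ι := Fintype.linearCombination A fun l : Fin d => (Pi.single (e l).1 1 : Fin x.rank → A)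
    with hι
  have happly : ∀ q i, ι q i = ∑ l, if i = (e l).1 then q l else 0 := by
    intro q i
    simp [hι, Fintype.linearCombination_apply, Pi.single_apply]
  have happly_e : ∀ q l, ι q (e l).1 = q l := by
    intro q l
    rw [happly, Finset.sum_eq_single l]
    · simp
    · intro l' _ hne
      rw [if_neg fun h => hne (e.injective (Subtype.ext h.symm))]
    · simp
  have happly_zero : ∀ q i, (∃ j, S.IsLM x.lt (x.gb j) (i, 0)) → ι q i = 0 := by
    rintro q i ⟨j, hj⟩
    rw [happly]
    refine Finset.sum_eq_zero fun l _ => if_neg ?_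
    rintro rfl
    exact (e l).2 j hj
  refine ⟨FreeSequence.isFiniteFreeResolution_precomp hx.isExact ?_ ⟨?_, ?_⟩,
    (FreeSequence.length_precomp _ _).trans hx.length_eq⟩
  · intro q q' h
    funext l
    rw [← happly_e q l, h, happly_e]
  · rw [Submodule.disjoint_def]
    rintro _ hξ ⟨q, rfl⟩
    by_contra h0
    obtain ⟨m, hm⟩ := S.exists_isLM (lt := x.lt) h0
    obtain ⟨j, γ, u, hu, rfl⟩ := ((S.isLeftGroebnerBasis_iff hlt).1 hx.isLeftGroebnerBasis).2 _ hξ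
      m hm
    refine hm.1 ?_
    have hu0 : u = (u.1, 0) := Prod.ext rfl (hdone j u hu)
    rw [coeff, shift_fst, happly_zero q u.1 ⟨j, hu0 ▸ hu⟩]
    simp
  · rw [codisjoint_iff, eq_top_iff]
    intro ξ _
    obtain ⟨q, η, hdiv⟩ := S.exists_divReturns x.gb hlt ξ
    obtain ⟨hsum, hred⟩ := hdiv.eq_and_isReduced S hlt
    rw [← hsum]
    refine Submodule.add_mem_sup (hx.isLeftGroebnerBasis.linearCombination_mem S q)
      ⟨fun l => η (e l).1, ?_⟩
    funext i
    by_cases hi : ∃ j, S.IsLM x.lt (x.gb j) (i, 0)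
    · rw [happly_zero _ _ hi]
      obtain ⟨j, hj⟩ := hi
      -- If e_i is a leading monomial, it divides every monomial of component i, so a reduced
      -- remainder vanishes there.
      refine (S.pbw.repr.injective (Finsupp.ext fun α => ?_)).symm
      by_contra h
      exact hred (i, α) (by simpa [coeff] using h) j _ hj α (by simp [shift])
    · push Not at hi
      obtain ⟨l, hl⟩ := e.surjective ⟨i, hi⟩
      have : i = (e l).1 := by rw [hl]
      rw [this, happly_e]

theorem FRESReaches.invariant {s m : ℕ} {φ₀ : (Fin s → A) →ₗ[A] M}
    {lt : Fin s × (Fin n → ℕ) → Fin s × (Fin n → ℕ) → Prop} {G : Fin m → Fin s → A}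
    (hin : S.IsFRESInput φ₀ lt G) {k : ℕ} {x : FRESState n A M}
    (hx : S.FRESReaches φ₀ lt G k x) : k ≤ n ∧ S.FRESInvariant k x := by
  induction hx with
  | init =>
    exact ⟨Nat.zero_le n, hin.surjective, rfl, hin.isLeftMonomialOrder, hin.isLeftGroebnerBasis,
      fun j m _ a ha => absurd ha (Nat.not_lt_zero _)⟩
  | step hx hxy ih =>
    refine ⟨?_, ih.2.step hxy⟩
    -- A pass beginning at k ≥ n is impossible: all n variables are already eliminated, so the
    -- stopping condition holds.
    by_contra hk
    have hdone := ih.2.stops (by omega)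
    cases hxy with
    | mk C lt G G' H hgo => exact hgo hdone

theorem FRESInvariant.exists_step_or_returns {k : ℕ} {x : FRESState n A M}
    (hx : S.FRESInvariant k x) :
    (∃ y, S.FRESStep x y) ∨ ∃ (d : ℕ) (R : FreeSequence A M d), S.FRESReturns x R := by
  by_cases h : S.FRESStops x
  · exact Or.inr h.exists_returns
  · exact Or.inl (hx.exists_step h)

theorem FRESInvariant.exists_isFiniteFreeResolution {k : ℕ} {x : FRESState n A M}
    (hx : S.FRESInvariant k x) :
    ∃ (d : ℕ) (R : FreeSequence A M d), R.IsFiniteFreeResolution := by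
  -- The number of variables not yet known to be eliminated bounds the remaining passes.
  induction h : n - k generalizing k x with
  | zero =>
    obtain ⟨d, R, hR⟩ := (hx.stops (by omega)).exists_returns
    exact ⟨d, R, (hx.isFiniteFreeResolution hR).1⟩
  | succ j ih =>
    rcases hx.exists_step_or_returns with ⟨y, hy⟩ | ⟨d, R, hR⟩
    · exact ih (hx.step hy) (by omega)
    · exact ⟨d, R, (hx.isFiniteFreeResolution hR).1⟩

variable (S)

theorem exists_isFRESInput {s : ℕ} (φ₀ : (Fin s → A) →ₗ[A] M) (hφ₀ : Function.Surjective φ₀) :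
    ∃ (m : ℕ) (lt : Fin s × (Fin n → ℕ) → Fin s × (Fin n → ℕ) → Prop)
      (G : Fin m → Fin s → A), S.IsFRESInput φ₀ lt G := by
  have hlt := S.isLeftMonomialOrder_lex s
  obtain ⟨m, G, hG⟩ := S.exists_isLeftGroebnerBasis (LinearMap.ker φ₀) hlt
  exact ⟨m, _, G, hφ₀, hlt, hG⟩

include S in
theorem exists_isFiniteFreeResolution (M : Type*) [AddCommGroup M] [Module A M]
    [Module.Finite A M] : ∃ (d : ℕ) (R : FreeSequence A M d), R.IsFiniteFreeResolution := by
  obtain ⟨s, φ₀, hφ₀⟩ := Module.Finite.exists_fin' A M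
  obtain ⟨m, lt, G, hin⟩ := S.exists_isFRESInput φ₀ hφ₀
  exact (FRESReaches.init.invariant hin).2.exists_isFiniteFreeResolution

end SolvablePolynomialAlgebra

theorem theorem3p3p3 {K A : Type*} [Field K] [Ring A] [Algebra K A] {n : ℕ}
    (S : SolvablePolynomialAlgebra K A n)
    (P : Type*) [AddCommGroup P] [Module A P] [Module.Finite A P] [Module.Projective A P] :
    ∃ t : ℕ,
      -- `P` is stably free, of a uniquely determined rank `t`
      (IsStablyFreeOfRank A P t ∧ ∀ t' : ℕ, IsStablyFreeOfRank A P t' → t' = t) ∧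
      -- the rank is the alternating sum of the ranks in any finite free resolution
      (∀ (r : ℕ) (C : FreeSequence A P r), C.IsFiniteFreeResolution → (t : ℤ) = C.altRank) ∧
      -- Algorithm-FRES has an input for every presentation of `P` by a free module `A^s`
      (∀ (s : ℕ) (φ₀ : (Fin s → A) →ₗ[A] P), Function.Surjective φ₀ →
        ∃ (m : ℕ) (lt : Fin s × (Fin n → ℕ) → Fin s × (Fin n → ℕ) → Prop)
          (G : Fin m → Fin s → A), S.IsFRESInput φ₀ lt G) ∧
      -- on every such input, Algorithm-FRES stops after at most `n` passes through its loop
      -- without ever getting stuck, and returns a finite free resolution of `P` of length at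
      -- most `n`, the alternating sum of whose ranks is the rank of `P`
      (∀ (s m : ℕ) (φ₀ : (Fin s → A) →ₗ[A] P)
        (lt : Fin s × (Fin n → ℕ) → Fin s × (Fin n → ℕ) → Prop) (G : Fin m → Fin s → A),
        S.IsFRESInput φ₀ lt G →
        ∀ (k : ℕ) (x : FRESState n A P), S.FRESReaches φ₀ lt G k x →
          k ≤ n ∧
          ((∃ y, S.FRESStep x y) ∨ ∃ (d : ℕ) (R : FreeSequence A P d), S.FRESReturns x R) ∧
          ∀ (d : ℕ) (R : FreeSequence A P d), S.FRESReturns x R →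
            R.IsFiniteFreeResolution ∧ R.length ≤ n ∧ R.altRank = (t : ℤ)) := by
  have := S.strongRankCondition
  -- One resolution fixes t; every other resolution, including the algorithm's output, is compared
  -- with it through `IsStablyFreeOfRank.eq_sub_of_equiv`.
  obtain ⟨d, R, hR⟩ := S.exists_isFiniteFreeResolution P
  obtain ⟨a, b, hab, ⟨e⟩⟩ := hR.exists_equiv
  obtain ⟨t, ht, hfree⟩ := isStablyFreeOfRank_of_equiv e
  have halt : ∀ (r : ℕ) (C : FreeSequence A P r), C.IsFiniteFreeResolution →
      (t : ℤ) = C.altRank := by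
    intro r C hC
    obtain ⟨a', b', hab', ⟨e'⟩⟩ := hC.exists_equiv
    rw [← hab', hfree.eq_sub_of_equiv e']
  refine ⟨t, ⟨hfree, fun t' ht' => ?_⟩, halt, fun s φ₀ => S.exists_isFRESInput φ₀, ?_⟩
  · have := ht'.eq_sub_of_equiv e
    omega
  · intro s m φ₀ lt G hin k x hx
    obtain ⟨hk, hinv⟩ := hx.invariant hin
    refine ⟨hk, hinv.exists_step_or_returns, fun d R hR => ?_⟩
    obtain ⟨hres, hlen⟩ := hinv.isFiniteFreeResolution hR
    exact ⟨hres, hlen.trans_le hk, (halt d R hres).symm⟩
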